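/- **Setup.** Fix $J\ge 1$ and the state space $\mathcal J=\mathcal J^{\mathrm p}\cup\mathcal J^{\mathrm f}$ with $\mathcal J^{\mathrm p}=\{0,\dots,J\}$ (premium paying) and $\mathcal J^{\mathrm f}=\{J+1,\dots,2J+1\}$ (free policy); $J$ and $2J+1$ are surrender states. On a probability space $(\Omega,\mathbb F,\mathbb P)$ let $Z=\{Z(t)\}_{t\ge0}$ be a càdlàg non-explosive Markov jump process on $\mathcal J$ with $Z(0)\equiv z_0$ and locally integrable transition rates $\mu_{jk}\ge 0$, such that $\mathcal J^{\mathrm f}$ is absorbing and can be reached only by a transition $0\to J+1$, the states $J$ and $2J+1$ are absorbing, and they can be reached only from $0$ and $J+1$, respectively. Put $\mu_{j\bullet}=\sum_{k\ne j}\mu_{jk}$. Let $S=(S_0,S_1)$ be a measurable $\mathbb R^2$-valued (price) process independent of $Z$, and let $\mathcal F^S,\mathcal F^Z$ be the natural filtrations of $S$ and $Z$, and $\mathcal F=\mathcal F^S\vee\mathcal F^Z$. *Technical reserves.* The technical basis consists of an integrable deterministic short rate $r^\star$ on $[0,n]$, $n\in(0,\infty)$, and integrable transition rates $\mu^\star_{jk}\ge0$,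 $j\neq k$, on the biometric states $\{0,\dots,J-1\}$, with transition probabilities $p^\star_{jk}$. For payments on these states with sojourn rates $b_j$ and transition payments $b_{jk}$ (with $b_j$ and $b_{jk}\mu^\star_{jk}$ integrable on $[0,n]$) the technical reserve is $$\widetilde V_j(t)=\int_t^n e^{-\int_t^s r^\star(v)\,\mathrm dv}\sum_{k<J}p^\star_{jk}(t,s)\Big(b_k(s)+\sum_{l<J,\,l\neq k}b_{kl}(s)\mu^\star_{kl}(s)\Big)\mathrm ds ,\qquad j<J,\ 0\le t\le n,$$ and $\widetilde V_j(t)=0$ for $t>n$ (surrender and free policy conversion are value-neutral on the technical basis). Let $\widetilde V^{\star}$, $\widetilde V^{\star,+}$ and $\widetilde V^{\star,\dagger}$ be the reserves of, respectively, the predetermined payments, the positive parts (benefits) of the predetermined payments, and non-negative unit bonus payments. Set $V^{\star,\dagger}_j=\widetilde V^{\star,\dagger}_j$ for $j<J$, $V^{\star,\dagger}_j=\widetilde V^{\star,\dagger}_{j-(J+1)}$ for $J+1\le j\le 2J$, and $V^{\star,\dagger}_j=0$ for $j\in\{J,2J+1\}$. The free policy factor is $\rho(0)=1$, $\rho(t)=\widetilde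 V^\star_0(t)/\widetilde V^{\star,+}_0(t)$ for $t>0$, and it is assumed that $\rho\in[0,1]$. Let $\tau=\inf\{t\ge0:Z(t)\in\mathcal J^{\mathrm f}\}$. Quotients with denominator $0$ are read as $0$. *Dividends and bonus.* For $i=0,1,2$ and $j\in\mathcal J$ let $(t,\omega)\mapsto\delta_i(t,j)(\omega)$ be measurable and adapted to $\mathcal F^S$ (up to null sets), and let $$\delta(t)=\delta_0(t,Z(t))+\delta_1(t,Z(t))\,\rho(\tau)^{\mathbf 1_{(\tau\le t)}}+\delta_2(t,Z(t))\,Q(t),$$ where the number $Q(t)$ of additional benefits is $\mathcal F$-adapted (up to null sets) and satisfies almost surely, for all $t\geq 0$, $$Q(t)=\int_0^t\frac{\delta(u)}{V^{\star,\dagger}_{Z(u)}(u)}\,\mathrm du .$$ Assume that each of the three terms of $\delta(u)/V^{\star,\dagger}_{Z(u)}(u)$ is integrable over $[0,t]\times\Omega$ for all $t$. Put $$p_{z_0j}(0,t)=\mathbb P(Z(t)=j\mid Z(0)=z_0),\qquad p^\rho_{z_0j}(0,t)=\mathbb E\big[\mathbf 1_{(Z(t)=j)}\rho(\tau)^{\mathbf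 1_{(\tau\le t)}}\mid Z(0)=z_0\big],$$ $$p^Q_{z_0j}(0,t)=\mathbb E\big[Q(t)\mathbf 1_{(Z(t)=j)}\mid\mathcal F^S(t)\big].$$ **Theorem.** $Q(t)$ is integrable for every $t\ge 0$, and the $Q$-modified transition probabilities have versions (for every $j$ and every $t\geq0$ equal almost surely to the conditional expectation above), again denoted $p^Q_{z_0j}(0,t)$, that almost surely satisfy, for all $j\in\mathcal J$, $p^Q_{z_0j}(0,0)=0$ and the differential equations $$\frac{\mathrm d}{\mathrm dt}p^Q_{z_0j}(0,t)=\frac{p_{z_0j}(0,t)\delta_0(t,j)+p^\rho_{z_0j}(0,t)\delta_1(t,j)+p^Q_{z_0j}(0,t)\delta_2(t,j)}{V^{\star,\dagger}_j(t)}-p^Q_{z_0j}(0,t)\mu_{j\bullet}(t)+\sum_{k\in\mathcal J,\,k\ne j}p^Q_{z_0k}(0,t)\mu_{kj}(t)$$ in the following sense: the right-hand side is locally integrable and $p^Q_{z_0j}(0,t)$ equals its integral over $[0,t]$ for all $t\ge0$; the differential equation holds for Lebesgue-almost every $t>0$; and it holds at every $t\ge0$ (as a right derivative for $t=0$) at which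 $\mu_{jk},\mu_{kj}$, $k\ne j$, and $\delta_i(\cdot,j)/V^{\star,\dagger}_j$, $i=0,1,2$, are continuous. -/

import Mathlib

open MeasureTheory ProbabilityTheory Filter Topology Set
open scoped ENNReal

namespace LifeBonus

noncomputable section

/-- Total rate `∑_{k ≠ j} μ_{jk}(t)` of leaving state `j`. -/
def exitRate {ι : Type*} [Fintype ι] [DecidableEq ι] (μ : ι → ι → ℝ → ℝ) (j : ι) (t : ℝ) : ℝ :=
  ∑ k ∈ Finset.univ.erase j, μ j k t

/-- The generator matrix at time `t` of the transition rates `μ` (diagonal values of `μ` are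
never used). -/
def rateMatrix {ι : Type*} [Fintype ι] [DecidableEq ι] (μ : ι → ι → ℝ → ℝ) (t : ℝ) :
    Matrix ι ι ℝ :=
  fun j k => if j = k then -exitRate μ j t else μ j k t

/-- Iterated integrals
`I₀(s,t) = 1`, `I_{m+1}(s,t) = ∫_s^t I_m(s,u) A(u) du` of a matrix function `A`. -/
def iteratedIntegral {ι : Type*} [Fintype ι] [DecidableEq ι] (A : ℝ → Matrix ι ι ℝ) :
    ℕ → ℝ → ℝ → Matrix ι ι ℝ
  | 0, _, _ => 1
  | m + 1, s, t => fun j k => ∫ u in s..t, (iteratedIntegral A m s u * A u) j k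

/-- Transition probabilities `p_{jk}(s,t)`, `s ≤ t`, of the Markov jump process with rates `μ`:
the product integral (Peano--Baker series) of the generator matrix. -/
def transition {ι : Type*} [Fintype ι] [DecidableEq ι] (μ : ι → ι → ℝ → ℝ) (s t : ℝ) (j k : ι) :
    ℝ :=
  ∑' m : ℕ, iteratedIntegral (rateMatrix μ) m s t j k

/-! ### State space -/

/-- `{0, …, 2J+1}`: the states `0, …, J` are premium paying, `J+1, …, 2J+1` are free policy
states, `J` and `2J+1` are the two surrender states. -/
abbrev State (J : ℕ) : Type := Fin (2 * J + 2)

/-- The free policy states `J+1, …, 2J+1`. -/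
def IsFree {J : ℕ} (j : State J) : Prop := J + 1 ≤ j.val

/-- Transition rates on the market basis: nonnegative, locally integrable, and respecting the
structure of the state space with the two policyholder options. -/
structure IsMarketRates {J : ℕ} (μ : State J → State J → ℝ → ℝ) : Prop where
  nonneg : ∀ j k, j ≠ k → ∀ t, 0 ≤ t → 0 ≤ μ j k t
  integrable : ∀ j k, j ≠ k → ∀ t, 0 ≤ t → IntervalIntegrable (μ j k) volume 0 t
  /-- The free policy states are absorbing as a whole. -/
  free_absorbing : ∀ j k, IsFree j → ¬ IsFree k → ∀ t, 0 ≤ t → μ j k t = 0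
  /-- They can only be reached by the transition `0 → J+1`. -/
  free_entry : ∀ j k, ¬ IsFree j → IsFree k → ¬ (j.val = 0 ∧ k.val = J + 1) →
    ∀ t, 0 ≤ t → μ j k t = 0
  /-- The surrender states `J` and `2J+1` are absorbing. -/
  surrender_absorbing : ∀ j k, j ≠ k → (j.val = J ∨ j.val = 2 * J + 1) → ∀ t, 0 ≤ t → μ j k t = 0
  /-- Surrender as premium paying is only possible from `0`. -/
  surrender_entry : ∀ j k, j ≠ k → k.val = J → j.val ≠ 0 → ∀ t, 0 ≤ t → μ j k t = 0
  /-- Surrender as free policy is only possible from `J+1`. -/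
  surrender_free_entry : ∀ j k, j ≠ k → k.val = 2 * J + 1 → j.val ≠ J + 1 →
    ∀ t, 0 ≤ t → μ j k t = 0

/-! ### Technical basis, technical reserves, free policy factor -/

/-- Technical (first order) basis for the biometric states `0, …, J-1` (premium paying states
without surrender): a deterministic short rate `r`, transition rates `μ`, and the maximal
contract time `n`. -/
structure TechnicalBasis (J : ℕ) where
  r : ℝ → ℝ
  μ : Fin J → Fin J → ℝ → ℝ
  n : ℝ
  n_pos : 0 < n
  r_integrable : IntervalIntegrable r volume 0 n
  μ_nonneg : ∀ j k, j ≠ k → ∀ t, 0 ≤ t → 0 ≤ μ j k t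
  μ_integrable : ∀ j k, j ≠ k → IntervalIntegrable (μ j k) volume 0 n

/-- A payment plan in the biometric states: sojourn payment rates `b_j` and transition
payments `b_{jk}`, `k ≠ j` (benefits are positive, premiums negative). -/
structure Payments (J : ℕ) where
  rate : Fin J → ℝ → ℝ
  lump : Fin J → Fin J → ℝ → ℝ

/-- The benefit part `b_j⁺`, `b_{jk}⁺` of a payment plan. -/
def Payments.benefits {J : ℕ} (B : Payments J) : Payments J where
  rate j t := max (B.rate j t) 0
  lump j k t := max (B.lump j k t) 0

/-- Integrability of the payments with respect to a technical basis. -/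
structure Payments.Regular {J : ℕ} (B : Payments J) (T : TechnicalBasis J) : Prop where
  rate_integrable : ∀ j, IntervalIntegrable (B.rate j) volume 0 T.n
  lump_integrable : ∀ j k, j ≠ k →
    IntervalIntegrable (fun s => B.lump j k s * T.μ j k s) volume 0 T.n

/-- State-wise technical reserve of a payment plan: the expected present value at time `t`, on
the technical basis and given state `j` at time `t`, of the payments over `(t, n]`.

Surrender pays out the technical reserve and free policy conversion leaves it unchanged, so that
neither option contributes to technical reserves; they are the ones of the biometric states, and
they solve Thiele's differential equations there with terminal value `0` at time `n`. -/
def technicalReserve {J : ℕ} (T : TechnicalBasis J) (B : Payments J) (j : Fin J) (t : ℝ) : ℝ :=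
  ∫ s in Ioc t T.n, Real.exp (-∫ v in t..s, T.r v) *
    ∑ k, transition T.μ t s j k *
      (B.rate k s + ∑ l ∈ Finset.univ.erase k, B.lump k l s * T.μ k l s)

/-- Technical unit reserve in all states: the reserve of the unit bonus payments `B` in the
biometric states, the same values in their free policy copies, `0` in the surrender states. -/
def unitReserve {J : ℕ} (T : TechnicalBasis J) (B : Payments J) (j : State J) (t : ℝ) : ℝ :=
  if h : j.val < J then technicalReserve T B ⟨j.val, h⟩ t
  else if h : J + 1 ≤ j.val ∧ j.val - (J + 1) < J then
    technicalReserve T B ⟨j.val - (J + 1), h.2⟩ t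
  else 0

/-- Free policy factor: the technical reserve of the predetermined payments `B` in state `0`
divided by the technical reserve of their benefit part; `1` at time `0`. -/
def freePolicyFactor {J : ℕ} (hJ : 0 < J) (T : TechnicalBasis J) (B : Payments J) (t : ℝ) : ℝ :=
  if t ≤ 0 then 1
  else technicalReserve T B ⟨0, hJ⟩ t / technicalReserve T B.benefits ⟨0, hJ⟩ t

/-! ### State of the insured and financial market -/

/-- The information `σ(X(u) : 0 ≤ u ≤ t)` generated by a process up to time `t`. -/
@[reducible] def hist {Ω E : Type*} [MeasurableSpace E] (X : ℝ → Ω → E) (t : ℝ) :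
    MeasurableSpace Ω :=
  ⨆ u ∈ Icc (0 : ℝ) t, MeasurableSpace.comap (X u) inferInstance

/-- A non-explosive jump process on a finite state space with deterministic initial state:
piecewise constant right-continuous paths with left limits in the discrete topology, hence with
finitely many jumps on compacts. -/
structure IsJumpProcess {Ω : Type*} [MeasurableSpace Ω] {J : ℕ} (Z : ℝ → Ω → State J)
    (z₀ : State J) : Prop where
  measurable : ∀ t, 0 ≤ t → Measurable (Z t)
  initial : ∀ ω, Z 0 ω = z₀
  right_continuous : ∀ ω t, 0 ≤ t → ∀ᶠ u in 𝓝[>] t, Z u ω = Z t ω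
  left_limits : ∀ ω t, 0 < t → ∃ i, ∀ᶠ u in 𝓝[<] t, Z u ω = i

/-- `Z` is a Markov process with transition rates `μ` under `P`: it has the Markov property, and
for every function `f` of the state,
`f(Z(t)) - ∫_0^t ∑_{k ≠ Z(u)} μ_{Z(u) k}(u) (f(k) - f(Z(u))) du`
is a martingale for the filtration generated by `Z`. -/
structure IsMarkovWithRates {Ω : Type*} [MeasurableSpace Ω] (P : Measure Ω) {J : ℕ}
    (Z : ℝ → Ω → State J) (μ : State J → State J → ℝ → ℝ) : Prop where
  markov : ∀ s t, 0 ≤ s → s ≤ t → ∀ j,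
    P[({ω | Z t ω = j}.indicator fun _ => (1 : ℝ)) | hist Z s] =ᵐ[P]
      P[({ω | Z t ω = j}.indicator fun _ => (1 : ℝ)) | MeasurableSpace.comap (Z s) inferInstance]
  martingale : ∀ f : State J → ℝ, ∀ s t, 0 ≤ s → s ≤ t →
    P[(fun ω => f (Z t ω) - ∫ u in (0 : ℝ)..t,
        ∑ k ∈ Finset.univ.erase (Z u ω), μ (Z u ω) k u * (f k - f (Z u ω))) | hist Z s] =ᵐ[P]
      fun ω => f (Z s ω) - ∫ u in (0 : ℝ)..s,
        ∑ k ∈ Finset.univ.erase (Z u ω), μ (Z u ω) k u * (f k - f (Z u ω))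

/-- The time `τ = inf {t ≥ 0 : Z(t) is a free policy state} ∈ [0, ∞]` of conversion. -/
def conversionTime {Ω : Type*} {J : ℕ} (Z : ℝ → Ω → State J) (ω : Ω) : ℝ≥0∞ :=
  ⨅ (t : ℝ) (_ : 0 ≤ t ∧ IsFree (Z t ω)), ENNReal.ofReal t

open Classical in
/-- `ρ(τ)` to the power `1_{τ ≤ t}`. -/
def conversionFactor {Ω : Type*} {J : ℕ} (ρ : ℝ → ℝ) (Z : ℝ → Ω → State J) (t : ℝ) (ω : Ω) : ℝ :=
  if conversionTime Z ω ≤ ENNReal.ofReal t then ρ (conversionTime Z ω).toReal else 1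

/-- `p_{z₀ j}(0,t) = P(Z(t) = j | Z(0) = z₀)`. -/
def prob {Ω : Type*} [MeasurableSpace Ω] (P : Measure Ω) {J : ℕ} (Z : ℝ → Ω → State J)
    (z₀ j : State J) (t : ℝ) : ℝ :=
  (P[|{ω | Z 0 ω = z₀}]).real {ω | Z t ω = j}

/-- The `ρ`-modified transition probability
`p^ρ_{z₀ j}(0,t) = E[1_{Z(t) = j} ρ(τ)^{1_{τ ≤ t}} | Z(0) = z₀]`. -/
def probRho {Ω : Type*} [MeasurableSpace Ω] (P : Measure Ω) {J : ℕ} (ρ : ℝ → ℝ)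
    (Z : ℝ → Ω → State J) (z₀ j : State J) (t : ℝ) : ℝ :=
  ∫ ω, {ω | Z t ω = j}.indicator (conversionFactor ρ Z t) ω ∂(P[|{ω | Z 0 ω = z₀}])

/-- The `Q`-modified transition probability
`p^Q_{z₀ j}(0,t) = E[Q(t) 1_{Z(t) = j} | F^S(t)]`, a random variable determined almost surely. -/
def probQ {Ω : Type*} [MeasurableSpace Ω] (P : Measure Ω) {J : ℕ} (S : ℝ → Ω → ℝ × ℝ)
    (Z : ℝ → Ω → State J) (Q : ℝ → Ω → ℝ) (j : State J) (t : ℝ) : Ω → ℝ :=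
  P[{ω | Z t ω = j}.indicator (Q t) | hist S t]

/-! ### Dividends and bonus -/

/-- Coefficients `δ_i(t, j)` of a dividend strategy that, for every fixed state `j`, depend
only on the financial information: measurable in `(t, ω)` and (up to null sets) adapted to the
filtration generated by `S`. This covers every measurable mapping of `t`, `j`, the stopped path
`S(· ∧ t)` and `F^S(t)`-measurable quantities. -/
structure IsDividendCoefficient {Ω : Type*} [MeasurableSpace Ω] (P : Measure Ω) {J : ℕ}
    (S : ℝ → Ω → ℝ × ℝ) (δ : State J → ℝ → Ω → ℝ) : Prop where
  measurable : ∀ j, Measurable (Function.uncurry (δ j))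
  adapted : ∀ j t, 0 ≤ t → AEStronglyMeasurable[hist S t] (δ j t) P

/-- The dividend yield
`δ(t) = δ₀(t,Z(t)) + δ₁(t,Z(t)) ρ(τ)^{1_{τ ≤ t}} + δ₂(t,Z(t)) Q(t)`. -/
def dividendYield {Ω : Type*} {J : ℕ} (ρ : ℝ → ℝ) (Z : ℝ → Ω → State J)
    (δ₀ δ₁ δ₂ : State J → ℝ → Ω → ℝ) (Q : ℝ → Ω → ℝ) (t : ℝ) (ω : Ω) : ℝ :=
  δ₀ (Z t ω) t ω + δ₁ (Z t ω) t ω * conversionFactor ρ Z t ω + δ₂ (Z t ω) t ω * Q t ω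

/-- `Q` is the number of additional benefits held: an adapted process with
`dQ(t) = δ(t) / V_{Z(t)}(t) dt`, `Q(0) = 0`, where the three parts of `δ/V` have finite
expected total variation on compact time intervals. -/
structure IsBonusProcess {Ω : Type*} [MeasurableSpace Ω] (P : Measure Ω) {J : ℕ}
    (V : State J → ℝ → ℝ) (ρ : ℝ → ℝ) (S : ℝ → Ω → ℝ × ℝ) (Z : ℝ → Ω → State J)
    (δ₀ δ₁ δ₂ : State J → ℝ → Ω → ℝ) (Q : ℝ → Ω → ℝ) : Prop where
  adapted : ∀ t, 0 ≤ t → AEStronglyMeasurable[hist S t ⊔ hist Z t] (Q t) P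
  integrable₀ : ∀ T, 0 ≤ T → Integrable
    (fun x : ℝ × Ω => δ₀ (Z x.1 x.2) x.1 x.2 / V (Z x.1 x.2) x.1)
    ((volume.restrict (Icc 0 T)).prod P)
  integrable₁ : ∀ T, 0 ≤ T → Integrable
    (fun x : ℝ × Ω => δ₁ (Z x.1 x.2) x.1 x.2 * conversionFactor ρ Z x.1 x.2 / V (Z x.1 x.2) x.1)
    ((volume.restrict (Icc 0 T)).prod P)
  integrable₂ : ∀ T, 0 ≤ T → Integrable
    (fun x : ℝ × Ω => δ₂ (Z x.1 x.2) x.1 x.2 * Q x.1 x.2 / V (Z x.1 x.2) x.1)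
    ((volume.restrict (Icc 0 T)).prod P)
  integral_eq : ∀ᵐ ω ∂P, ∀ t, 0 ≤ t →
    Q t ω = ∫ u in (0 : ℝ)..t, dividendYield ρ Z δ₀ δ₁ δ₂ Q u ω / V (Z u ω) u

/-- Right-hand side of the differential equations for `q_j = p^Q_{z₀ j}(0,·)` in a fixed financial
scenario: source term, minus outflow, plus inflow. -/
def qDrift {J : ℕ} (μ : State J → State J → ℝ → ℝ) (V p pρ d₀ d₁ d₂ q : State J → ℝ → ℝ)
    (j : State J) (t : ℝ) : ℝ :=
  (p j t * d₀ j t + pρ j t * d₁ j t + q j t * d₂ j t) / V j t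
    - q j t * exitRate μ j t + ∑ k ∈ Finset.univ.erase j, q k t * μ k j t

end

end LifeBonus

open LifeBonus

namespace LifeBonus

/-! ### Measurability of the technical reserves -/

/-! Write G for `⨆ t, hist S t`, the whole price information, h for the purchase rate `bonusRate`,
so that Q(t) = ∫₀ᵗ h almost surely, and Λ for the generator `rateMatrix μ`. The compensated
indicator M_j(t) = 1_{Z(t)=j} - ∫₀ᵗ Λ_{Z(u)j}(u) du is a martingale, and it stays one when the
filtration is enlarged by the independent G (`condExp_sup_compMartingale`). As Q is absolutely
continuous, no stochastic integral is needed: for A in G, Fubini and the fact that h(u) is known at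
time u give E[1_A Q(t) M_j(t)] = E[1_A ∫₀ᵗ h(u) M_j(u) du], and ordinary integration by parts
handles the compensator. Together (`setIntegral_timeIntegral_mul_occ`), E[1_A Q(t) 1_{Z(t)=j}] =
E[1_A ∫₀ᵗ (h 1_{Z=j} + Q Λ_{Zj}) du].

The exceptional null sets must not depend on t. Therefore the integrand is conditioned once, on
[0,T] × Ω and given Borel ⊗ G, which yields a jointly measurable ψ_j. The paths ∫₀ᵗ ψ_j are then
versions of E[Q(t) 1_{Z(t)=j} | G] for every t (`IsDriftVersion.ae_eq_condExp`). Here G may be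
replaced by F^S(t), because Q(t) is determined by the histories of S and Z up to t and the latter is
independent of G (`condExp_eq_of_indep`).

It remains to compute ψ_j (`IsDriftVersion.ae_eq_qDrift`). The quotients δ_i(·,j)/V_j are Borel ⊗
G-measurable up to null sets and factor out. By independence of S and Z the remaining factors become
p and p^ρ, while the factor Q 1_{Z=k} becomes ∫ψ_k, so the system closes. Differentiability almost
everywhere is Lebesgue's theorem. At continuity points of the coefficients it is the fundamental
theorem of calculus, since p and p^ρ are continuous: Z has no fixed jump times
(`ae_eventually_nhdsLT_eq`). -/

theorem measurable_setIntegral_Ioc {α : Type*} [MeasurableSpace α] {f : α → ℝ → ℝ} {a b : α → ℝ}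
    (hf : Measurable (Function.uncurry f)) (ha : Measurable a) (hb : Measurable b) :
    Measurable fun x => ∫ u in Ioc (a x) (b x), f x u := by
  have h : ∀ x, ∫ u in Ioc (a x) (b x), f x u
      = ∫ u, {p : α × ℝ | a p.1 < p.2 ∧ p.2 ≤ b p.1}.indicator (Function.uncurry f) (x, u) := by
    intro x
    -- The moving limits become the indicator of a jointly measurable set, so that Fubini's
    -- measurability statement applies.
    rw [← integral_indicator measurableSet_Ioc]
    rfl
  simp only [h]
  refine (StronglyMeasurable.integral_prod_right' (Measurable.stronglyMeasurable ?_)).measurable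
  refine hf.indicator (MeasurableSet.inter ?_ ?_)
  · exact measurableSet_lt (ha.comp measurable_fst) measurable_snd
  · exact measurableSet_le measurable_snd (hb.comp measurable_fst)

theorem measurable_intervalIntegral {α : Type*} [MeasurableSpace α] {f : α → ℝ → ℝ} {a b : α → ℝ}
    (hf : Measurable (Function.uncurry f)) (ha : Measurable a) (hb : Measurable b) :
    Measurable fun x => ∫ u in a x..b x, f x u := by
  simp only [intervalIntegral]
  exact (measurable_setIntegral_Ioc hf ha hb).sub (measurable_setIntegral_Ioc hf hb ha)

section Transition

variable {ι : Type*} [Fintype ι] [DecidableEq ι]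

theorem measurable_iteratedIntegral {A : ℝ → Matrix ι ι ℝ} (hA : ∀ j k, Measurable fun u => A u j k)
    (m : ℕ) (j k : ι) : Measurable fun p : ℝ × ℝ => iteratedIntegral A m p.1 p.2 j k := by
  induction m generalizing j k with
  | zero => exact measurable_const
  | succ m ih =>
    simp only [iteratedIntegral, Matrix.mul_apply]
    refine measurable_intervalIntegral ?_ measurable_fst measurable_snd
    refine Finset.measurable_fun_sum _ fun l _ => ?_
    exact ((ih j l).comp ((measurable_fst.comp measurable_fst).prodMk measurable_snd)).mul
      ((hA l k).comp measurable_snd)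

theorem iteratedIntegral_congr {A A' : ℝ → Matrix ι ι ℝ} {n : ℝ}
    (h : ∀ᵐ u ∂(volume.restrict (Ioc 0 n)), A u = A' u) (m : ℕ) {s t : ℝ}
    (hs : s ∈ Icc 0 n) (ht : t ∈ Icc 0 n) :
    iteratedIntegral A m s t = iteratedIntegral A' m s t := by
  induction m generalizing t with
  | zero => rfl
  | succ m ih =>
    funext j k
    refine intervalIntegral.integral_congr_ae ?_
    filter_upwards [(ae_restrict_iff' measurableSet_Ioc).1 h] with u hu hu'
    have hu0 : u ∈ Ioc 0 n := by
      rcases mem_uIoc.1 hu' with h | h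
      · exact ⟨hs.1.trans_lt h.1, h.2.trans ht.2⟩
      · exact ⟨ht.1.trans_lt h.1, h.2.trans hs.2⟩
    rw [hu hu0, ih ⟨hu0.1.le, hu0.2⟩]

/-- The rates are only almost everywhere equal to Borel functions on (0, n]. Iterated integrals with
both limits in [0, n] do not see the change to Borel versions, and for those versions the
Peano–Baker series is jointly measurable. -/
theorem exists_measurable_transition {μ : ι → ι → ℝ → ℝ} {n : ℝ}
    (hμ : ∀ j k, j ≠ k → AEStronglyMeasurable (μ j k) (volume.restrict (Ioc 0 n))) :
    ∃ p : ι → ι → ℝ × ℝ → ℝ, (∀ j k, Measurable (p j k)) ∧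
      ∀ j k, ∀ s ∈ Icc 0 n, ∀ t ∈ Icc 0 n, transition μ s t j k = p j k (s, t) := by
  classical
  let μ' : ι → ι → ℝ → ℝ := fun j k => if h : j ≠ k then (hμ j k h).mk else 0
  have hμ' : ∀ j k, Measurable (μ' j k) := fun j k => by
    by_cases h : j ≠ k
    · simpa only [μ', dif_pos h] using (hμ j k h).stronglyMeasurable_mk.measurable
    · simpa only [μ', dif_neg h] using measurable_zero
  have hA : ∀ j k, Measurable fun u => rateMatrix μ' u j k := by
    intro j k
    simp only [rateMatrix, exitRate]
    split_ifs
    · exact (Finset.measurable_fun_sum _ fun l _ => hμ' j l).neg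
    · exact hμ' j k
  have hall : ∀ᵐ u ∂(volume.restrict (Ioc 0 n)), ∀ j k, j ≠ k → μ j k u = μ' j k u := by
    refine ae_all_iff.2 fun j => ae_all_iff.2 fun k => ?_
    by_cases h : j ≠ k
    · filter_upwards [(hμ j k h).ae_eq_mk] with u hu _
      simp only [μ', dif_pos h, hu]
    · exact Eventually.of_forall fun u hu => absurd hu h
  have hcongr : ∀ᵐ u ∂(volume.restrict (Ioc 0 n)), rateMatrix μ u = rateMatrix μ' u := by
    filter_upwards [hall] with u hu
    funext j k
    simp only [rateMatrix, exitRate]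
    split_ifs with h
    · exact congrArg _ (Finset.sum_congr rfl fun l hl => hu _ _ (Finset.ne_of_mem_erase hl).symm)
    · exact hu _ _ h
  refine ⟨fun j k p => transition μ' p.1 p.2 j k, fun j k => ?_, fun j k s hs t ht => ?_⟩
  · exact Measurable.tsum fun m => measurable_iteratedIntegral hA m j k
  · simp only [transition]
    exact tsum_congr fun m => by rw [iteratedIntegral_congr hcongr m hs ht]

end Transition

theorem exists_measurable_technicalReserve {J : ℕ} (T : TechnicalBasis J) {B : Payments J}
    (hB : B.Regular T) (j : Fin J) :
    ∃ g : ℝ → ℝ, Measurable g ∧ ∀ t, 0 ≤ t → technicalReserve T B j t = g t := by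
  have hmeas : ∀ {f : ℝ → ℝ}, IntervalIntegrable f volume 0 T.n →
      AEStronglyMeasurable f (volume.restrict (Ioc 0 T.n)) := fun h => h.1.aestronglyMeasurable
  obtain ⟨p, hp, hpeq⟩ := exists_measurable_transition (μ := T.μ) (n := T.n)
    fun j k h => hmeas (T.μ_integrable j k h)
  obtain ⟨r, hr, hreq⟩ := hmeas T.r_integrable
  have hpay : ∀ k, AEStronglyMeasurable
      (fun s => B.rate k s + ∑ l ∈ Finset.univ.erase k, B.lump k l s * T.μ k l s)
      (volume.restrict (Ioc 0 T.n)) := fun k =>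
    (hmeas (hB.rate_integrable k)).add (Finset.aestronglyMeasurable_fun_sum _
      fun l hl => hmeas (hB.lump_integrable k l (Finset.ne_of_mem_erase hl).symm))
  choose b hb hbeq using hpay
  refine ⟨fun t => ∫ s in Ioc t T.n, Real.exp (-∫ v in t..s, r v) * ∑ k, p j k (t, s) * b k s,
    ?_, fun t ht => ?_⟩
  · refine measurable_setIntegral_Ioc ?_ measurable_id measurable_const
    refine Measurable.mul (Real.measurable_exp.comp (Measurable.neg ?_)) ?_
    · exact measurable_intervalIntegral (hr.measurable.comp measurable_snd)
        measurable_fst measurable_snd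
    · exact Finset.measurable_fun_sum _ fun k _ => (hp j k).mul
        ((hb k).measurable.comp measurable_snd)
  · refine setIntegral_congr_ae measurableSet_Ioc ?_
    filter_upwards [(ae_restrict_iff' measurableSet_Ioc).1 (ae_all_iff.2 hbeq)] with s hs hst
    have hs0 : 0 < s := ht.trans_lt hst.1
    have h1 : ∫ v in t..s, T.r v = ∫ v in t..s, r v := by
      refine intervalIntegral.integral_congr_ae ?_
      filter_upwards [(ae_restrict_iff' measurableSet_Ioc).1 hreq] with v hv hv'
      rw [uIoc_of_le hst.1.le] at hv'
      exact hv ⟨ht.trans_lt hv'.1, hv'.2.trans hst.2⟩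
    rw [h1]
    congr 1
    refine Finset.sum_congr rfl fun k _ => ?_
    rw [hpeq j k t ⟨ht, hst.1.le.trans hst.2⟩ s ⟨hs0.le, hst.2⟩, hs ⟨hs0, hst.2⟩ k]

theorem Payments.Regular.benefits {J : ℕ} {T : TechnicalBasis J} {B : Payments J}
    (hB : B.Regular T) : B.benefits.Regular T where
  rate_integrable j := by
    refine intervalIntegrable_iff.2 ?_
    exact (intervalIntegrable_iff.1 (hB.rate_integrable j)).pos_part
  lump_integrable j k hjk := by
    have h := intervalIntegrable_iff.1 (hB.lump_integrable j k hjk)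
    refine intervalIntegrable_iff.2 (h.pos_part.congr ?_)
    filter_upwards [ae_restrict_mem measurableSet_uIoc] with s hs
    rw [uIoc_of_le T.n_pos.le] at hs
    have := T.μ_nonneg j k hjk s hs.1.le
    simp only [Payments.benefits, max_mul_of_nonneg _ _ this, zero_mul]

/-- Needed for ρ(τ) to be a random variable. -/
theorem measurable_freePolicyFactor {J : ℕ} (hJ : 0 < J) (T : TechnicalBasis J) {B : Payments J}
    (hB : B.Regular T) : Measurable (freePolicyFactor hJ T B) := by
  obtain ⟨g, hg, hgeq⟩ := exists_measurable_technicalReserve T hB ⟨0, hJ⟩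
  obtain ⟨g', hg', hgeq'⟩ := exists_measurable_technicalReserve T hB.benefits ⟨0, hJ⟩
  have : freePolicyFactor hJ T B = fun t => if t ≤ 0 then 1 else g t / g' t := by
    funext t
    simp only [freePolicyFactor]
    split_ifs with h
    · rfl
    · rw [hgeq t (not_le.1 h).le, hgeq' t (not_le.1 h).le]
  rw [this]
  exact Measurable.ite measurableSet_Iic measurable_const (hg.div hg')

theorem exists_measurable_unitReserve {J : ℕ} (T : TechnicalBasis J) {B : Payments J}
    (hB : B.Regular T) (j : State J) :
    ∃ g : ℝ → ℝ, Measurable g ∧ ∀ t, 0 ≤ t → unitReserve T B j t = g t := by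
  simp only [unitReserve]
  split_ifs
  · exact exists_measurable_technicalReserve T hB _
  · exact exists_measurable_technicalReserve T hB _
  · exact ⟨0, measurable_zero, fun _ _ => rfl⟩

/-! ### Histories, the state process and the time of conversion -/

section Hist

variable {Ω E : Type*} [MeasurableSpace E] {X : ℝ → Ω → E}

theorem hist_mono : Monotone (hist X) := fun _ _ hst =>
  iSup₂_mono' fun u hu => ⟨u, ⟨hu.1, hu.2.trans hst⟩, le_rfl⟩

theorem hist_le [m : MeasurableSpace Ω] (hX : ∀ t, 0 ≤ t → Measurable (X t)) (t : ℝ) :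
    hist X t ≤ m :=
  iSup₂_le fun u hu => (hX u hu.1).comap_le

theorem measurable_hist {u t : ℝ} (hu : 0 ≤ u) (hut : u ≤ t) : Measurable[hist X t] (X u) :=
  measurable_iff_comap_le.2 (le_iSup₂_of_le u ⟨hu, hut⟩ le_rfl)

end Hist

variable {Ω : Type*} {J : ℕ} {Z : ℝ → Ω → State J} {z₀ : State J}

theorem conversionTime_le {ω : Ω} {t : ℝ} (ht : 0 ≤ t) (h : IsFree (Z t ω)) :
    conversionTime Z ω ≤ ENNReal.ofReal t :=
  iInf₂_le t ⟨ht, h⟩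

theorem conversionTime_lt_iff {ω : Ω} {s : ℝ≥0∞} :
    conversionTime Z ω < s ↔ ∃ t, 0 ≤ t ∧ IsFree (Z t ω) ∧ ENNReal.ofReal t < s := by
  simp only [conversionTime, iInf_lt_iff, exists_prop, and_assoc]

theorem conversionFactor_of_le {ρ : ℝ → ℝ} {ω : Ω} {t : ℝ}
    (h : conversionTime Z ω ≤ ENNReal.ofReal t) :
    conversionFactor ρ Z t ω = ρ (conversionTime Z ω).toReal := if_pos h

theorem conversionFactor_of_lt {ρ : ℝ → ℝ} {ω : Ω} {t : ℝ}
    (h : ENNReal.ofReal t < conversionTime Z ω) : conversionFactor ρ Z t ω = 1 :=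
  if_neg (not_le.2 h)

theorem conversionFactor_one (t : ℝ) (ω : Ω) : conversionFactor (fun _ => 1) Z t ω = 1 := by
  simp only [conversionFactor, ite_self]

theorem conversionFactor_mem_Icc {ρ : ℝ → ℝ} (hρ : ∀ t, ρ t ∈ Icc (0 : ℝ) 1) (t : ℝ) (ω : Ω) :
    conversionFactor ρ Z t ω ∈ Icc (0 : ℝ) 1 := by
  simp only [conversionFactor]
  split_ifs
  · exact hρ _
  · exact ⟨zero_le_one, le_rfl⟩

theorem measurable_hist_of_ofReal_lt {t q : ℝ} {s : ℝ≥0∞} (hq : 0 ≤ q)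
    (hqs : ENNReal.ofReal q < s) (hst : s ≤ ENNReal.ofReal t) : Measurable[hist Z t] (Z q) :=
  measurable_hist hq (ENNReal.ofReal_lt_ofReal_iff'.1 (hqs.trans_le hst)).1.le

theorem conversionFactor_eventuallyEq_nhdsGT (ρ : ℝ → ℝ) (ω : Ω) (t : ℝ) :
    ∀ᶠ u in 𝓝[>] t, conversionFactor ρ Z u ω = conversionFactor ρ Z t ω := by
  by_cases h : conversionTime Z ω ≤ ENNReal.ofReal t
  · filter_upwards [self_mem_nhdsWithin] with u hu
    rw [conversionFactor_of_le h,
      conversionFactor_of_le (h.trans (ENNReal.ofReal_le_ofReal (mem_Ioi.1 hu).le))]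
  · rw [not_le] at h
    have hs : ∀ᶠ u in 𝓝 t, ENNReal.ofReal u < conversionTime Z ω :=
      ENNReal.continuous_ofReal.continuousAt.eventually_lt continuousAt_const h
    filter_upwards [mem_nhdsWithin_of_mem_nhds hs] with u hu
    rw [conversionFactor_of_lt h, conversionFactor_of_lt hu]

variable [MeasurableSpace Ω]

namespace IsJumpProcess

variable (hZ : IsJumpProcess Z z₀)
include hZ

theorem exists_pos_forall_eq (ω : Ω) {t : ℝ} (ht : 0 ≤ t) :
    ∃ ε > 0, ∀ u, t < u → u < t + ε → Z u ω = Z t ω := by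
  obtain ⟨b, hb, h⟩ := mem_nhdsGT_iff_exists_Ioo_subset.1 (hZ.right_continuous ω t ht)
  exact ⟨b - t, sub_pos.2 hb, fun u hu hu' => h ⟨hu, by linarith⟩⟩

/-- Joint measurability in time and scenario: by right-constancy, Z(t) = j exactly when, for some n,
Z equals j at all rationals in (t, t + 1/(n+1)). -/
theorem measurableSet_state (j : State J) :
    MeasurableSet {p : ℝ × Ω | 0 ≤ p.1 ∧ Z p.1 p.2 = j} := by
  have h : {p : ℝ × Ω | 0 ≤ p.1 ∧ Z p.1 p.2 = j} = {p | 0 ≤ p.1} ∩ ⋃ n : ℕ, ⋂ q : ℚ,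
      -- `max q 0` keeps the sampling times nonnegative, where Z is known to be measurable; it
      -- equals q whenever q > t ≥ 0.
      ({p | p.1 < (q : ℝ) ∧ (q : ℝ) < p.1 + 1 / (n + 1)}ᶜ ∪ {p | Z (max q 0) p.2 = j}) := by
    ext ⟨t, ω⟩
    refine and_congr_right fun ht => ?_
    obtain ⟨ε, hε, h⟩ := hZ.exists_pos_forall_eq ω ht
    simp only [mem_iUnion, mem_iInter, mem_union, mem_compl_iff, mem_ofPred_eq,
      ← imp_iff_not_or]
    constructor
    · intro hj
      obtain ⟨n, hn⟩ := exists_nat_one_div_lt hε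
      refine ⟨n, fun q hq => ?_⟩
      rw [max_eq_left (ht.trans hq.1.le), ← hj]
      exact h q hq.1 (by linarith [hq.2])
    · rintro ⟨n, hn⟩
      obtain ⟨q, hq, hq'⟩ := exists_rat_btwn
        (show t < t + min ε (1 / ((n : ℝ) + 1)) from lt_add_of_pos_right _
          (lt_min hε Nat.one_div_pos_of_nat))
      have h1 := h q hq (hq'.trans_le (by gcongr; exact min_le_left _ _))
      have h2 := hn q ⟨hq, hq'.trans_le (by gcongr; exact min_le_right _ _)⟩
      rw [max_eq_left (ht.trans hq.le)] at h2
      exact h1.symm.trans h2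
  rw [h]
  refine (measurableSet_le measurable_const measurable_fst).inter
    (MeasurableSet.iUnion fun n => MeasurableSet.iInter fun q => ?_)
  refine MeasurableSet.union (MeasurableSet.compl (MeasurableSet.inter ?_ ?_)) ?_
  · exact measurableSet_lt measurable_fst measurable_const
  · exact measurableSet_lt measurable_const (measurable_fst.add_const _)
  · exact ((hZ.measurable _ (le_max_right _ _)).comp measurable_snd)
      (measurableSet_singleton j)

theorem conversionTime_lt_iff_rat {ω : Ω} {s : ℝ≥0∞} :
    conversionTime Z ω < s ↔
      ∃ q : ℚ, (0 : ℝ) ≤ q ∧ ENNReal.ofReal q < s ∧ IsFree (Z q ω) := by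
  rw [conversionTime_lt_iff]
  constructor
  · rintro ⟨t, ht, hfree, hts⟩
    have hs : ∀ᶠ u in 𝓝 t, ENNReal.ofReal u < s :=
      ENNReal.continuous_ofReal.continuousAt.eventually_lt continuousAt_const hts
    obtain ⟨ε', hε', h'⟩ := Metric.eventually_nhds_iff.1 hs
    obtain ⟨ε, hε, h⟩ := hZ.exists_pos_forall_eq ω ht
    obtain ⟨q, hq, hq'⟩ := exists_rat_btwn
      (show t < t + min ε ε' from lt_add_of_pos_right _ (lt_min hε hε'))
    refine ⟨q, ht.trans hq.le, h' ?_, ?_⟩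
    · rw [Real.dist_eq, abs_of_pos (sub_pos.2 hq)]
      linarith [min_le_right ε ε']
    · rw [h q hq (by linarith [min_le_left ε ε'])]
      exact hfree
  · rintro ⟨q, hq, hqs, hfree⟩
    exact ⟨q, hq, hfree, hqs⟩

/-- The σ-algebra is left free, so that the same argument serves the ambient one and the history of
Z. -/
theorem measurableSet_conversionTime_lt (s : ℝ≥0∞) : ∀ m : MeasurableSpace Ω,
    (∀ q : ℚ, (0 : ℝ) ≤ q → ENNReal.ofReal q < s → Measurable[m] (Z q)) →
    MeasurableSet[m] {ω | conversionTime Z ω < s} := by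
  have h : {ω | conversionTime Z ω < s}
      = ⋃ q : ℚ, {ω | (0 : ℝ) ≤ q ∧ ENNReal.ofReal q < s ∧ IsFree (Z q ω)} := by
    ext ω
    simp only [mem_iUnion, mem_ofPred_eq, hZ.conversionTime_lt_iff_rat]
  intro m hm
  rw [h]
  refine MeasurableSet.iUnion fun q => ?_
  by_cases hq : (0 : ℝ) ≤ q ∧ ENNReal.ofReal q < s
  · have : {ω | (0 : ℝ) ≤ q ∧ ENNReal.ofReal q < s ∧ IsFree (Z q ω)}
        = Z q ⁻¹' {i | IsFree i} := by
      ext ω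
      simp only [hq.1, hq.2, true_and, mem_ofPred_eq, mem_preimage]
    rw [this]
    exact hm q hq.1 hq.2 (Set.toFinite _).measurableSet
  · have : {ω | (0 : ℝ) ≤ q ∧ ENNReal.ofReal q < s ∧ IsFree (Z q ω)} = ∅ :=
      eq_empty_of_forall_notMem fun ω h => hq ⟨h.1, h.2.1⟩
    rw [this]
    exact MeasurableSet.empty

theorem measurable_conversionTime : Measurable (conversionTime Z) :=
  measurable_of_Iio fun _ => hZ.measurableSet_conversionTime_lt _ _ fun q hq _ => hZ.measurable q hq

/-- The infimum defining τ is attained: Z is constant just after t, so free times decreasing to t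
force t itself to be free. -/
theorem isFree_of_conversionTime_eq {ω : Ω} {t : ℝ} (ht : 0 ≤ t)
    (h : conversionTime Z ω = ENNReal.ofReal t) : IsFree (Z t ω) := by
  obtain ⟨ε, hε, hc⟩ := hZ.exists_pos_forall_eq ω ht
  have h1 : conversionTime Z ω < ENNReal.ofReal (t + ε) := by
    rw [h]
    exact (ENNReal.ofReal_lt_ofReal_iff (by linarith)).2 (by linarith)
  obtain ⟨u, hu, hfree, hut⟩ := conversionTime_lt_iff.1 h1
  rw [ENNReal.ofReal_lt_ofReal_iff (by linarith)] at hut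
  rcases lt_trichotomy u t with h2 | h2 | h2
  · have h3 := conversionTime_le hu hfree
    rw [h] at h3
    exact absurd ((ENNReal.ofReal_le_ofReal_iff hu).1 h3) (not_le.2 h2)
  · rwa [h2] at hfree
  · rwa [hc u h2 hut] at hfree

/-- Makes τ a stopping time of the raw filtration: since the infimum is attained, the event {τ = t}
is visible in Z(t) and no right-continuous enlargement is required. -/
theorem measurableSet_conversionTime_le {t : ℝ} (ht : 0 ≤ t) :
    MeasurableSet[hist Z t] {ω | conversionTime Z ω ≤ ENNReal.ofReal t} := by
  have h : {ω | conversionTime Z ω ≤ ENNReal.ofReal t}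
      = {ω | conversionTime Z ω < ENNReal.ofReal t} ∪ Z t ⁻¹' {i | IsFree i} := by
    ext ω
    simp only [mem_union, mem_preimage, mem_ofPred_eq, le_iff_lt_or_eq]
    constructor
    · rintro (h | h)
      · exact Or.inl h
      · exact Or.inr (hZ.isFree_of_conversionTime_eq ht h)
    · rintro (h | h)
      · exact Or.inl h
      · exact le_iff_lt_or_eq.1 (conversionTime_le ht h)
  rw [h]
  refine MeasurableSet.union ?_ (measurable_hist ht le_rfl (Set.toFinite _).measurableSet)
  exact hZ.measurableSet_conversionTime_lt _ _
    fun q hq hqt => measurable_hist_of_ofReal_lt hq hqt le_rfl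

theorem measurable_hist_conversionFactor {ρ : ℝ → ℝ} (hρ : Measurable ρ) {t : ℝ} (ht : 0 ≤ t) :
    Measurable[hist Z t] (conversionFactor ρ Z t) := by
  -- τ itself is not known at time t, but min(τ, t) is, and the two agree on {τ ≤ t}, the only place
  -- where ρ(τ) is evaluated.
  have hmin : Measurable[hist Z t] fun ω => min (conversionTime Z ω) (ENNReal.ofReal t) := by
    refine measurable_of_Iio (δ := Ω) fun s => ?_
    by_cases hs : s ≤ ENNReal.ofReal t
    · have : (fun ω => min (conversionTime Z ω) (ENNReal.ofReal t)) ⁻¹' Iio s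
          = {ω | conversionTime Z ω < s} := by
        ext ω
        simp only [mem_preimage, mem_Iio, min_lt_iff, not_lt.2 hs, or_false, mem_ofPred_eq]
      rw [this]
      exact hZ.measurableSet_conversionTime_lt _ _
        fun q hq hqt => measurable_hist_of_ofReal_lt hq hqt hs
    · have : (fun ω => min (conversionTime Z ω) (ENNReal.ofReal t)) ⁻¹' Iio s = univ :=
        eq_univ_of_forall fun ω => (min_le_right _ _).trans_lt (not_le.1 hs)
      rw [this]
      exact MeasurableSet.univ
  classical
  have : conversionFactor ρ Z t = fun ω => if conversionTime Z ω ≤ ENNReal.ofReal t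
      then ρ (min (conversionTime Z ω) (ENNReal.ofReal t)).toReal else 1 := by
    funext ω
    simp only [conversionFactor]
    split_ifs with h
    · rw [min_eq_left h]
    · rfl
  rw [this]
  exact Measurable.ite (hZ.measurableSet_conversionTime_le ht)
    (hρ.comp (ENNReal.measurable_toReal.comp hmin)) measurable_const

theorem measurable_conversionFactor {ρ : ℝ → ℝ} (hρ : Measurable ρ) :
    Measurable fun p : ℝ × Ω => conversionFactor ρ Z p.1 p.2 := by
  have hτ := hZ.measurable_conversionTime.comp (measurable_snd : Measurable (Prod.snd : ℝ × Ω → Ω))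
  exact Measurable.ite
    (measurableSet_le hτ (ENNReal.measurable_ofReal.comp measurable_fst))
    (hρ.comp (ENNReal.measurable_toReal.comp hτ)) measurable_const

theorem conversionFactor_eventuallyEq_nhdsLT (ρ : ℝ → ℝ) {ω : Ω} {t : ℝ} (ht : 0 < t)
    (hjump : ∀ᶠ u in 𝓝[<] t, Z u ω = Z t ω) :
    ∀ᶠ u in 𝓝[<] t, conversionFactor ρ Z u ω = conversionFactor ρ Z t ω := by
  rcases lt_trichotomy (conversionTime Z ω) (ENNReal.ofReal t) with h | h | h
  · have hs : ∀ᶠ u in 𝓝 t, conversionTime Z ω < ENNReal.ofReal u :=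
      continuousAt_const.eventually_lt ENNReal.continuous_ofReal.continuousAt h
    filter_upwards [mem_nhdsWithin_of_mem_nhds hs] with u hu
    rw [conversionFactor_of_le h.le, conversionFactor_of_le hu.le]
  -- If τ = t, then Z(t) is free; without a jump at t, Z is free slightly earlier as well, against
  -- the definition of τ.
  · exfalso
    have hpos : ∀ᶠ u in 𝓝[<] t, 0 ≤ u :=
      mem_nhdsWithin_of_mem_nhds (le_mem_nhds ht)
    obtain ⟨u, ⟨hu, hu0⟩, hut⟩ := ((hjump.and hpos).and self_mem_nhdsWithin).exists
    have hfree := hZ.isFree_of_conversionTime_eq ht.le h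
    rw [← hu] at hfree
    have := conversionTime_le hu0 hfree
    rw [h, ENNReal.ofReal_le_ofReal_iff hu0] at this
    exact absurd this (not_le.2 hut)
  · filter_upwards [self_mem_nhdsWithin] with u hu
    rw [conversionFactor_of_lt h, conversionFactor_of_lt
      ((ENNReal.ofReal_le_ofReal (mem_Iio.1 hu).le).trans_lt h)]

end IsJumpProcess

/-! ### Conditional expectations: independent enlargements and product spaces -/

section CondExp

variable {Ω : Type*}

theorem setIntegral_eq_of_isPiSystem {m m' : MeasurableSpace Ω} {P : Measure[m] Ω} (hm : m' ≤ m)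
    {s : Set (Set Ω)} (hgen : m' = MeasurableSpace.generateFrom s) (hs : IsPiSystem s)
    {X Y : Ω → ℝ} (hX : Integrable X P) (hY : Integrable Y P) (huniv : ∫ ω, X ω ∂P = ∫ ω, Y ω ∂P)
    (h : ∀ A ∈ s, ∫ ω in A, X ω ∂P = ∫ ω in A, Y ω ∂P) {D : Set Ω} (hD : MeasurableSet[m'] D) :
    ∫ ω in D, X ω ∂P = ∫ ω in D, Y ω ∂P := by
  induction D, hD using MeasurableSpace.induction_on_inter hgen hs with
  | empty => simp
  | basic t ht => exact h t ht
  | compl t htm ht =>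
    rw [setIntegral_compl (hm _ htm) hX, setIntegral_compl (hm _ htm) hY, huniv, ht]
  | iUnion f hd hfm hf =>
    rw [integral_iUnion (fun i => hm _ (hfm i)) hd hX.integrableOn,
      integral_iUnion (fun i => hm _ (hfm i)) hd hY.integrableOn]
    exact tsum_congr hf

theorem setIntegral_eq_of_sup {m G F : MeasurableSpace Ω} {P : Measure[m] Ω} (hG : G ≤ m)
    (hF : F ≤ m) {X Y : Ω → ℝ} (hX : Integrable X P) (hY : Integrable Y P)
    (h : ∀ A B, MeasurableSet[G] A → MeasurableSet[F] B →
      ∫ ω in A ∩ B, X ω ∂P = ∫ ω in A ∩ B, Y ω ∂P) {D : Set Ω} (hD : MeasurableSet[G ⊔ F] D) :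
    ∫ ω in D, X ω ∂P = ∫ ω in D, Y ω ∂P := by
  -- Intersections A ∩ B with A in G and B in F form a π-system generating the join.
  have hgen : G ⊔ F = MeasurableSpace.generateFrom
      (image2 (· ∩ ·) {A | MeasurableSet[G] A} {B | MeasurableSet[F] B}) := by
    refine le_antisymm (sup_le (fun A hA => ?_) fun B hB => ?_)
      (MeasurableSpace.generateFrom_le ?_)
    · exact MeasurableSpace.measurableSet_generateFrom
        ⟨A, hA, univ, MeasurableSet.univ, inter_univ A⟩
    · exact MeasurableSpace.measurableSet_generateFrom
        ⟨univ, MeasurableSet.univ, B, hB, univ_inter B⟩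
    · rintro _ ⟨A, hA, B, hB, rfl⟩
      exact MeasurableSet.inter (le_sup_left (a := G) (b := F) _ hA)
        (le_sup_right (a := G) (b := F) _ hB)
  refine setIntegral_eq_of_isPiSystem (sup_le hG hF) hgen ?_ hX hY ?_ ?_ hD
  · rintro _ ⟨A, hA, B, hB, rfl⟩ _ ⟨A', hA', B', hB', rfl⟩ -
    exact ⟨A ∩ A', MeasurableSet.inter hA hA', B ∩ B', MeasurableSet.inter hB hB',
      inter_inter_inter_comm _ _ _ _⟩
  · simpa using h univ univ MeasurableSet.univ MeasurableSet.univ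
  · rintro _ ⟨A, hA, B, hB, rfl⟩
    exact h A B hA hB

theorem setIntegral_eq_of_indep {m G F : MeasurableSpace Ω} {P : Measure[m] Ω}
    [IsProbabilityMeasure P] (hG : G ≤ m) (hF : F ≤ m) (hGF : Indep F G P) {X : Ω → ℝ}
    (hX : StronglyMeasurable[F] X) (hXint : Integrable X P) {A : Set Ω}
    (hA : MeasurableSet[G] A) : ∫ ω in A, X ω ∂P = P.real A * ∫ ω, X ω ∂P := by
  rw [← setIntegral_condExp hG hXint hA, setIntegral_congr_ae (hG _ hA)
    ((condExp_indep_eq hF hG hX hGF).mono fun ω hω _ => hω), setIntegral_const, smul_eq_mul]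

/-- Enlarging a σ-algebra by independent information leaves a conditional expectation
unchanged. -/
theorem condExp_sup_of_indep {m G F F' : MeasurableSpace Ω} {P : Measure[m] Ω}
    [IsProbabilityMeasure P] (hG : G ≤ m) (hF' : F' ≤ m) (hF : F ≤ F') (hGF : Indep F' G P)
    {X : Ω → ℝ} (hX : StronglyMeasurable[F'] X) (hXint : Integrable X P) :
    P[X | G ⊔ F] =ᵐ[P] P[X | F] := by
  refine (ae_eq_condExp_of_forall_setIntegral_eq (sup_le hG (hF.trans hF')) hXint
    (fun s _ _ => integrable_condExp.integrableOn) (fun D hD _ => ?_)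
    (stronglyMeasurable_condExp.mono (le_sup_right (a := G))).aestronglyMeasurable).symm
  refine setIntegral_eq_of_sup hG (hF.trans hF') integrable_condExp hXint
    (fun A B hA hB => ?_) hD
  have hB' := hF _ hB
  have h : ∀ Y : Ω → ℝ, StronglyMeasurable[F'] Y → Integrable Y P →
      ∫ ω in A ∩ B, Y ω ∂P = P.real A * ∫ ω in B, Y ω ∂P := fun Y hY hYint => by
    rw [← setIntegral_indicator (hF' _ hB'), ← integral_indicator (hF' _ hB')]
    exact setIntegral_eq_of_indep hG hF' hGF (hY.indicator hB')
      (hYint.indicator (hF' _ hB')) hA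
  rw [h _ (stronglyMeasurable_condExp.mono hF) integrable_condExp, h _ hX hXint,
    setIntegral_condExp (hF.trans hF') hXint hB]

/-- Self-adjointness of conditional expectation. It trades an arbitrary event A for a G-measurable
weight when the integrand is G-measurable. -/
theorem setIntegral_eq_integral_condExp_mul {m G : MeasurableSpace Ω} {P : Measure[m] Ω}
    [IsFiniteMeasure P] (hG : G ≤ m) {X : Ω → ℝ} (hX : AEStronglyMeasurable[G] X P)
    (hXint : Integrable X P) {A : Set Ω} (hA : MeasurableSet[m] A) :
    ∫ ω in A, X ω ∂P = ∫ ω, X ω * (P[A.indicator fun _ => (1 : ℝ) | G]) ω ∂P := by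
  have h1 : X * A.indicator (fun _ => (1 : ℝ)) = A.indicator X := by
    funext ω
    by_cases h : ω ∈ A <;> simp [h]
  have hint : Integrable (X * A.indicator fun _ => (1 : ℝ)) P := h1 ▸ hXint.indicator hA
  rw [← integral_indicator hA, ← h1, ← integral_condExp hG]
  exact integral_congr_ae (condExp_mul_of_aestronglyMeasurable_left hX hint
    ((integrable_const _).indicator hA))

theorem integrable_mul_condExp_indicator {m G : MeasurableSpace Ω} {P : Measure[m] Ω}
    [IsFiniteMeasure P] {X : Ω → ℝ} (hXint : Integrable X P) (A : Set Ω) :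
    Integrable (fun ω => X ω * (P[A.indicator fun _ => (1 : ℝ) | G]) ω) P := by
  refine hXint.mul_bdd (c := 1) integrable_condExp.aestronglyMeasurable ?_
  refine ae_bdd_norm_condExp_of_ae_bdd_norm (Eventually.of_forall fun ω => ?_)
  by_cases h : ω ∈ A <;> simp [h]

/-- Conditioning on additional information that is independent of the remaining randomness. -/
theorem condExp_eq_of_indep {m G G' F : MeasurableSpace Ω} {P : Measure[m] Ω}
    [IsProbabilityMeasure P] (hG' : G' ≤ m) (hF : F ≤ m) (hG : G ≤ G') (hGF : Indep G' F P)
    {X : Ω → ℝ} (hX : AEStronglyMeasurable[G ⊔ F] X P) (hXint : Integrable X P) :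
    P[X | G'] =ᵐ[P] P[X | G] := by
  refine (ae_eq_condExp_of_forall_setIntegral_eq hG' hXint
    (fun s _ _ => integrable_condExp.integrableOn) (fun A hA _ => ?_)
    (stronglyMeasurable_condExp.mono hG).aestronglyMeasurable).symm
  -- The projection is moved onto the test event: E[X 1_A] = E[X E[1_A | F ⊔ G]] = E[X E[1_A | G]] =
  -- E[E[X | G] 1_A], where the middle equality is the independent enlargement of G by F.
  have h1 : P[A.indicator fun _ => (1 : ℝ) | F ⊔ G] =ᵐ[P] P[A.indicator fun _ => (1 : ℝ) | G] :=
    condExp_sup_of_indep hF hG' hG hGF (stronglyMeasurable_const.indicator hA)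
      ((integrable_const _).indicator (hG' _ hA))
  have hle := hG.trans hG'
  rw [setIntegral_eq_integral_condExp_mul (sup_le hF hle) (sup_comm G F ▸ hX) hXint (hG' _ hA),
    setIntegral_eq_integral_condExp_mul hle stronglyMeasurable_condExp.aestronglyMeasurable
      integrable_condExp (hG' _ hA),
    integral_congr_ae (h1.mono fun ω hω => congrArg (X ω * ·) hω),
    ← integral_condExp hle (f := fun ω => X ω * _)]
  exact integral_congr_ae (condExp_mul_of_aestronglyMeasurable_right (f := X)
    stronglyMeasurable_condExp.aestronglyMeasurable
    (integrable_mul_condExp_indicator hXint A) hXint).symm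

end CondExp

/-! ### Conditional expectations given a product σ-algebra -/

section Product

variable {α Ω : Type*} [mα : MeasurableSpace α] {G m : MeasurableSpace Ω} {l : Measure α}
  [IsFiniteMeasure l] {P : Measure Ω} [IsFiniteMeasure P]

theorem prod_le_prod (hG : G ≤ m) : mα.prod G ≤ mα.prod m :=
  sup_le_sup le_rfl (MeasurableSpace.comap_mono hG)

omit [IsFiniteMeasure l] [IsFiniteMeasure P] in
theorem setIntegral_prod_eq_of_rectangles (hG : G ≤ m) {X Y : α × Ω → ℝ}
    (hX : Integrable X (l.prod P)) (hY : Integrable Y (l.prod P))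
    (h : ∀ B A, MeasurableSet B → MeasurableSet[G] A →
      ∫ p in B ×ˢ A, X p ∂(l.prod P) = ∫ p in B ×ˢ A, Y p ∂(l.prod P))
    {D : Set (α × Ω)} (hD : MeasurableSet[mα.prod G] D) :
    ∫ p in D, X p ∂(l.prod P) = ∫ p in D, Y p ∂(l.prod P) := by
  refine setIntegral_eq_of_isPiSystem (prod_le_prod hG) (@generateFrom_prod α Ω mα G).symm
    (@isPiSystem_prod α Ω mα G) hX hY ?_ ?_ hD
  · simpa using h univ univ MeasurableSet.univ MeasurableSet.univ
  · rintro _ ⟨B, hB, A, hA, rfl⟩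
    exact h B A hB hA

theorem ae_eq_condExp_prod_of_rectangles (hG : G ≤ m) {X Y : α × Ω → ℝ}
    (hX : Integrable X (l.prod P)) (hY : Integrable Y (l.prod P))
    (hYm : AEStronglyMeasurable[mα.prod G] Y (l.prod P))
    (h : ∀ B A, MeasurableSet B → MeasurableSet[G] A →
      ∫ p in B ×ˢ A, X p ∂(l.prod P) = ∫ p in B ×ˢ A, Y p ∂(l.prod P)) :
    Y =ᵐ[l.prod P] (l.prod P)[X | mα.prod G] :=
  ae_eq_condExp_of_forall_setIntegral_eq (prod_le_prod hG) hX (fun _ _ _ => hY.integrableOn)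
    (fun _ hD _ => (setIntegral_prod_eq_of_rectangles hG hX hY h hD).symm) hYm

/-- The null sets of the individual sections cannot be united over uncountably many times. Instead D
is shown to coincide with its own conditional expectation given the product σ-algebra, by
integrating both over rectangles. -/
theorem aestronglyMeasurable_prod_of_bounded (hG : G ≤ m) {D : α × Ω → ℝ} (hD : Measurable D)
    {C : ℝ} (hC : ∀ p, ‖D p‖ ≤ C)
    (hDG : ∀ᵐ u ∂l, AEStronglyMeasurable[G] (fun ω => D (u, ω)) P) :
    AEStronglyMeasurable[mα.prod G] D (l.prod P) := by
  have hDint : Integrable D (l.prod P) :=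
    Integrable.of_bound hD.aestronglyMeasurable C (Eventually.of_forall hC)
  set E := (l.prod P)[D | mα.prod G] with hE
  have hEm : StronglyMeasurable[mα.prod G] E := stronglyMeasurable_condExp
  have hEint : Integrable E (l.prod P) := integrable_condExp
  suffices h : D =ᵐ[l.prod P] E from ⟨E, hEm, h⟩
  have key : ∀ B A, MeasurableSet B → MeasurableSet[m] A →
      ∫ p in B ×ˢ A, E p ∂(l.prod P) = ∫ p in B ×ˢ A, D p ∂(l.prod P) := by
    intro B A hB hA
    set g := P[A.indicator fun _ => (1 : ℝ) | G] with hg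
    have hgm : StronglyMeasurable[G] g := stronglyMeasurable_condExp
    have hgb : ∀ᵐ ω ∂P, ‖g ω‖ ≤ 1 := by
      refine ae_bdd_norm_condExp_of_ae_bdd_norm (Eventually.of_forall fun ω => ?_)
      by_cases h : ω ∈ A <;> simp [h]
    have hgb' : ∀ᵐ p ∂(l.prod P), ‖g p.2‖ ≤ 1 := Measure.quasiMeasurePreserving_snd.ae hgb
    have hgm' : StronglyMeasurable[mα.prod G] fun p : α × Ω => g p.2 :=
      hgm.comp_measurable (@measurable_snd α Ω mα G)
    have hmul : ∀ X : α × Ω → ℝ, Integrable X (l.prod P) →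
        Integrable (fun p => X p * g p.2) (l.prod P) := fun X hX =>
      hX.mul_bdd (hgm'.mono (prod_le_prod hG)).aestronglyMeasurable hgb'
    -- Section by section, 1_A may be replaced by g = E[1_A | G]; afterwards only Borel ⊗
    -- G-measurable test functions occur.
    have h1 : ∀ X : α × Ω → ℝ, Integrable X (l.prod P) →
        (∀ᵐ u ∂l, AEStronglyMeasurable[G] (fun ω => X (u, ω)) P) →
        ∫ p in B ×ˢ A, X p ∂(l.prod P) = ∫ p in B ×ˢ univ, X p * g p.2 ∂(l.prod P) := by
      intro X hX hXG
      rw [setIntegral_prod _ hX.integrableOn, setIntegral_prod _ (hmul X hX).integrableOn]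
      refine integral_congr_ae (ae_restrict_of_ae ?_)
      filter_upwards [hXG, hX.prod_right_ae] with u hu hu'
      rw [setIntegral_univ, setIntegral_eq_integral_condExp_mul hG hu hu' hA]
    rw [h1 D hDint hDG, h1 E hEint (Eventually.of_forall fun u =>
      (hEm.comp_measurable (@measurable_prodMk_left α Ω mα G u)).aestronglyMeasurable),
      ← setIntegral_condExp (prod_le_prod hG) (hmul D hDint)
      (@MeasurableSet.prod α Ω mα G _ _ hB MeasurableSet.univ)]
    refine integral_congr_ae (ae_restrict_of_ae ?_)
    exact (condExp_mul_of_aestronglyMeasurable_right hgm'.aestronglyMeasurable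
      (hmul D hDint) hDint).symm
  refine Integrable.ae_eq_of_forall_setIntegral_eq _ _ hDint hEint fun D hD _ => ?_
  exact setIntegral_prod_eq_of_rectangles le_rfl hDint hEint
    (fun B A hB hA => (key B A hB hA).symm) hD

/-- A measurable process whose sections are measurable with respect to `G` up to null sets is, up
to a null set, measurable with respect to the product with `G`. -/
theorem aestronglyMeasurable_prod_of_sections (hG : G ≤ m) {D : α × Ω → ℝ} (hD : Measurable D)
    (hDG : ∀ᵐ u ∂l, AEStronglyMeasurable[G] (fun ω => D (u, ω)) P) :
    AEStronglyMeasurable[mα.prod G] D (l.prod P) := by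
  -- Composition with arctan reduces to the bounded case, and tan undoes it.
  have h : AEStronglyMeasurable[mα.prod G] (fun p => Real.arctan (D p)) (l.prod P) := by
    refine aestronglyMeasurable_prod_of_bounded hG (Real.measurable_arctan.comp hD) (C := Real.pi / 2)
      (fun p => ?_) ?_
    · rw [Real.norm_eq_abs, abs_le]
      exact ⟨(Real.neg_pi_div_two_lt_arctan _).le, (Real.arctan_lt_pi_div_two _).le⟩
    · filter_upwards [hDG] with u hu
      exact Real.continuous_arctan.comp_aestronglyMeasurable hu
  obtain ⟨E, hE, hDE⟩ := h
  have htan : Measurable Real.tan := by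
    rw [show Real.tan = fun x => Real.sin x / Real.cos x from funext Real.tan_eq_sin_div_cos]
    exact Real.measurable_sin.div Real.measurable_cos
  refine ⟨fun p => Real.tan (E p), (htan.comp hE.measurable).stronglyMeasurable, ?_⟩
  filter_upwards [hDE] with p hp
  rw [← hp, Real.tan_arctan]

end Product

/-! ### Gluing conditional expectations over growing time intervals -/

section LocalVersion

variable {Ω : Type*} {G m : MeasurableSpace Ω} {P : Measure Ω} [IsFiniteMeasure P]

theorem prod_restrict_Icc_restrict {S T : ℝ} (hST : S ≤ T) :
    ((volume.restrict (Icc 0 T)).prod P).restrict (Icc 0 S ×ˢ univ)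
      = (volume.restrict (Icc 0 S)).prod P := by
  rw [← Measure.prod_restrict, Measure.restrict_univ, Measure.restrict_restrict measurableSet_Icc,
    inter_eq_left.2 (Icc_subset_Icc_right hST)]

theorem condExp_prod_restrict_Icc (hG : G ≤ m) {φ : ℝ × Ω → ℝ} {S T : ℝ} (hST : S ≤ T)
    (hφ : Integrable φ ((volume.restrict (Icc 0 T)).prod P)) :
    ((volume.restrict (Icc 0 S)).prod P)[φ | MeasurableSpace.prod inferInstance G]
      =ᵐ[(volume.restrict (Icc 0 S)).prod P]
    ((volume.restrict (Icc 0 T)).prod P)[φ | MeasurableSpace.prod inferInstance G] := by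
  have h := condExp_restrict_ae_eq_restrict (prod_le_prod (α := ℝ) hG)
    (@MeasurableSet.prod ℝ Ω _ G _ _ (measurableSet_Icc (a := (0 : ℝ)) (b := S))
      MeasurableSet.univ) hφ
  rwa [prod_restrict_Icc_restrict hST] at h

/-- The conditional expectations of a locally integrable process over the time intervals
`[0, T]` have a common version. -/
theorem exists_condExp_prod_version (hG : G ≤ m) {φ : ℝ × Ω → ℝ}
    (hφ : ∀ T, 0 ≤ T → Integrable φ ((volume.restrict (Icc 0 T)).prod P)) :
    ∃ ψ : ℝ × Ω → ℝ, StronglyMeasurable[MeasurableSpace.prod inferInstance G] ψ ∧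
      ∀ T, 0 ≤ T → ψ =ᵐ[(volume.restrict (Icc 0 T)).prod P]
        ((volume.restrict (Icc 0 T)).prod P)[φ | MeasurableSpace.prod inferInstance G] := by
  set E : ℕ → ℝ × Ω → ℝ := fun n =>
    ((volume.restrict (Icc 0 (n : ℝ))).prod P)[φ | MeasurableSpace.prod inferInstance G]
  have hE : ∀ n, Measurable[MeasurableSpace.prod inferInstance G] (E n) :=
    fun n => stronglyMeasurable_condExp.measurable
  -- At time t the version belonging to [0, ⌈t⌉] is used. The versions agree on overlaps, because
  -- restricting the measure to a set of the conditioning σ-algebra leaves the conditional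
  -- expectation unchanged there.
  refine ⟨fun p => E ⌈p.1⌉₊ p, ?_, fun T hT => ?_⟩
  · refine Measurable.stronglyMeasurable ?_
    have h1 : @Measurable (ℕ × (ℝ × Ω)) ℝ
        (MeasurableSpace.prod inferInstance (MeasurableSpace.prod inferInstance G)) _
        fun q => E q.1 q.2 :=
      @measurable_from_prod_countable_right ℕ (ℝ × Ω) ℝ _
        (MeasurableSpace.prod inferInstance G) _ _ _ _ hE
    refine h1.comp (Measurable.prodMk ?_ measurable_id)
    exact Nat.measurable_ceil.comp (@measurable_fst ℝ Ω _ G)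
  · obtain ⟨N, hN⟩ := exists_nat_ge T
    have hN0 : (0 : ℝ) ≤ N := N.cast_nonneg
    have h2 := condExp_prod_restrict_Icc hG hN (hφ N hN0)
    have h3 : ∀ᵐ p ∂(volume.restrict (Icc 0 T)).prod P, ∀ n : ℕ, n ≤ N →
        p ∈ Icc (0 : ℝ) n ×ˢ (univ : Set Ω) → E n p = E N p := by
      refine ae_all_iff.2 fun n => ?_
      by_cases hn : n ≤ N
      · have hn' : (n : ℝ) ≤ N := Nat.cast_le.2 hn
        have h4 := condExp_prod_restrict_Icc hG hn' (hφ N hN0)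
        rw [← prod_restrict_Icc_restrict hn', EventuallyEq,
          ae_restrict_iff' (measurableSet_Icc.prod MeasurableSet.univ)] at h4
        rw [← prod_restrict_Icc_restrict hN]
        filter_upwards [ae_restrict_of_ae h4] with p hp _ hmem
        have := hp hmem
        rwa [prod_restrict_Icc_restrict hn'] at this
      · exact Eventually.of_forall fun p h => absurd h hn
    have h5 : ∀ᵐ p ∂(volume.restrict (Icc 0 T)).prod P, p.1 ∈ Icc 0 T :=
      Measure.quasiMeasurePreserving_fst.ae (ae_restrict_mem measurableSet_Icc)
    filter_upwards [h2, h3, h5] with p hp hp' hpT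
    rw [hp]
    exact hp' _ (Nat.ceil_le.2 (hpT.2.trans hN)) ⟨⟨hpT.1, Nat.le_ceil _⟩, mem_univ _⟩

end LocalVersion

/-! ### Time integrals of processes -/

section TimeIntegral

/-- Lebesgue measure on `[0, T]` times `P`. -/
noncomputable abbrev timeProd {Ω : Type*} [MeasurableSpace Ω] (P : Measure Ω) (T : ℝ) : Measure (ℝ × Ω) :=
  (volume.restrict (Icc 0 T)).prod P

/-- The process `∫₀ᵗ h(u) du`. -/
noncomputable def timeIntegral {Ω : Type*} (h : ℝ × Ω → ℝ) (p : ℝ × Ω) : ℝ :=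
  ∫ u in (0 : ℝ)..p.1, h (u, p.2)

theorem intervalIntegral_eq_setIntegral_Icc {f : ℝ → ℝ} {t : ℝ} (ht : 0 ≤ t) :
    ∫ u in (0 : ℝ)..t, f u = ∫ u in Icc 0 t, f u := by
  rw [intervalIntegral.integral_of_le ht, integral_Icc_eq_integral_Ioc]

theorem intervalIntegrable_iff_integrable_Icc {f : ℝ → ℝ} {t : ℝ} (ht : 0 ≤ t) :
    IntervalIntegrable f volume 0 t ↔ Integrable f (volume.restrict (Icc 0 t)) :=
  intervalIntegrable_iff_integrableOn_Icc_of_le ht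

variable {Ω : Type*}

theorem stronglyMeasurable_timeIntegral {m : MeasurableSpace Ω} {h : ℝ × Ω → ℝ}
    (hh : StronglyMeasurable h) : StronglyMeasurable (timeIntegral h) :=
  (measurable_intervalIntegral (α := ℝ × Ω) (f := fun p u => h (u, p.2))
    (hh.measurable.comp (measurable_snd.prodMk (measurable_snd.comp measurable_fst)))
    measurable_const measurable_fst).stronglyMeasurable

theorem abs_timeIntegral_le {h : ℝ × Ω → ℝ} {t T : ℝ} {ω : Ω} (ht : t ∈ Icc 0 T)
    (hh : Integrable (fun u => h (u, ω)) (volume.restrict (Icc 0 T))) :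
    |timeIntegral h (t, ω)| ≤ ∫ u in Icc 0 T, |h (u, ω)| := by
  rw [timeIntegral, intervalIntegral_eq_setIntegral_Icc ht.1]
  refine (abs_integral_le_integral_abs).trans ?_
  exact setIntegral_mono_set hh.abs (Eventually.of_forall fun u => abs_nonneg _)
    (LE.le.eventuallyLE (Icc_subset_Icc_right ht.2))

/-- Integration by parts for two absolutely continuous primitives vanishing at 0. -/
theorem intervalIntegral_mul_intervalIntegral {f g : ℝ → ℝ} {t : ℝ}
    (hf : IntervalIntegrable f volume 0 t) (hg : IntervalIntegrable g volume 0 t) :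
    (∫ u in (0 : ℝ)..t, f u) * ∫ u in (0 : ℝ)..t, g u
      = ∫ u in (0 : ℝ)..t, (f u * ∫ v in (0 : ℝ)..u, g v) + (∫ v in (0 : ℝ)..u, f v) * g u := by
  have h := AbsolutelyContinuousOnInterval.integral_deriv_mul_eq_sub
    (hf.absolutelyContinuousOnInterval_intervalIntegral left_mem_uIcc)
    (hg.absolutelyContinuousOnInterval_intervalIntegral left_mem_uIcc)
  simp only [intervalIntegral.integral_same, mul_zero, sub_zero] at h
  rw [← h]
  refine intervalIntegral.integral_congr_ae ?_
  filter_upwards [hf.ae_hasDerivAt_integral, hg.ae_hasDerivAt_integral] with u hu hu' hmem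
  have hmem' := uIoc_subset_uIcc hmem
  rw [(hu hmem' 0 left_mem_uIcc).deriv, (hu' hmem' 0 left_mem_uIcc).deriv]

variable [MeasurableSpace Ω] {P : Measure Ω} {T : ℝ}

theorem ae_timeProd_mem : ∀ᵐ p ∂(timeProd P T), p.1 ∈ Icc 0 T :=
  Measure.quasiMeasurePreserving_fst.ae (ae_restrict_mem measurableSet_Icc)

theorem ae_timeProd_of_ae {q : ℝ × Ω → Prop} (h : ∀ᵐ ω ∂P, ∀ t ∈ Icc 0 T, q (t, ω)) :
    ∀ᵐ p ∂(timeProd P T), q p := by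
  filter_upwards [Measure.quasiMeasurePreserving_snd.ae h, ae_timeProd_mem] with p hp hp'
  exact hp _ hp'

variable [IsFiniteMeasure P]

theorem ae_ae_of_ae_timeProd {q : ℝ × Ω → Prop} (h : ∀ᵐ p ∂(timeProd P T), q p) :
    ∀ᵐ ω ∂P, ∀ᵐ u ∂(volume.restrict (Icc 0 T)), q (u, ω) :=
  Measure.ae_ae_of_ae_prod
    ((Measure.measurePreserving_swap (μ := P)).quasiMeasurePreserving.ae h)

theorem ae_integrable_section {h : ℝ × Ω → ℝ} (hh : Integrable h (timeProd P T)) :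
    ∀ᵐ ω ∂P, Integrable (fun u => h (u, ω)) (volume.restrict (Icc 0 T)) :=
  hh.prod_left_ae

theorem timeIntegral_congr_ae {h h' : ℝ × Ω → ℝ} (hh : h =ᵐ[timeProd P T] h') :
    ∀ᵐ ω ∂P, ∀ t ∈ Icc 0 T, timeIntegral h (t, ω) = timeIntegral h' (t, ω) := by
  filter_upwards [ae_ae_of_ae_timeProd hh] with ω hω t ht
  rw [timeIntegral, timeIntegral, intervalIntegral_eq_setIntegral_Icc ht.1,
    intervalIntegral_eq_setIntegral_Icc ht.1]
  exact integral_congr_ae (ae_mono (Measure.restrict_mono (Icc_subset_Icc_right ht.2) le_rfl) hω)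

theorem aestronglyMeasurable_timeIntegral {h : ℝ × Ω → ℝ}
    (hh : AEStronglyMeasurable h (timeProd P T)) :
    AEStronglyMeasurable (timeIntegral h) (timeProd P T) := by
  obtain ⟨h', hm, heq⟩ := hh
  exact ⟨timeIntegral h', stronglyMeasurable_timeIntegral hm,
    ae_timeProd_of_ae (timeIntegral_congr_ae heq)⟩

/-- Neither factor need be bounded: |∫₀ᵗ h| is dominated by a function of ω alone and |g| by a
function of t alone, and the product of the two bounds is integrable for the product measure. This
covers Q times a transition rate. -/
theorem integrable_timeIntegral_mul {h g : ℝ × Ω → ℝ} {b : ℝ → ℝ}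
    (hh : Integrable h (timeProd P T)) (hg : AEStronglyMeasurable g (timeProd P T))
    (hb : Integrable b (volume.restrict (Icc 0 T)))
    (hgb : ∀ᵐ p ∂(timeProd P T), |g p| ≤ b p.1) :
    Integrable (fun p => timeIntegral h p * g p) (timeProd P T) := by
  have hK : Integrable (fun ω => ∫ u in Icc 0 T, |h (u, ω)|) P := hh.abs.integral_prod_right
  refine (hb.mul_prod hK).mono' ((aestronglyMeasurable_timeIntegral hh.1).mul hg) ?_
  have h1 : ∀ᵐ p ∂(timeProd P T), |timeIntegral h p| ≤ ∫ u in Icc 0 T, |h (u, p.2)| :=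
    ae_timeProd_of_ae ((ae_integrable_section hh).mono fun ω hω t ht => abs_timeIntegral_le ht hω)
  filter_upwards [hgb, h1] with p hp hp'
  rw [norm_mul, Real.norm_eq_abs, Real.norm_eq_abs, mul_comm (b p.1)]
  exact mul_le_mul hp' hp (abs_nonneg _) ((abs_nonneg _).trans hp')

theorem integrable_timeIntegral {h : ℝ × Ω → ℝ} (hh : Integrable h (timeProd P T)) :
    Integrable (timeIntegral h) (timeProd P T) := by
  simpa using integrable_timeIntegral_mul (g := fun _ => 1) (b := fun _ => 1) hh
    aestronglyMeasurable_const (integrable_const _) (by simp)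

theorem integrable_timeIntegral_eval {h : ℝ × Ω → ℝ} (hT : 0 ≤ T)
    (hh : Integrable h (timeProd P T)) : Integrable (fun ω => timeIntegral h (T, ω)) P := by
  simp only [timeIntegral, intervalIntegral_eq_setIntegral_Icc hT]
  exact hh.integral_prod_right

theorem integrable_timeProd_restrict {h : ℝ × Ω → ℝ} (hh : Integrable h (timeProd P T))
    (A : Set Ω) : Integrable h (timeProd (P.restrict A) T) := by
  have := hh.restrict (s := univ ×ˢ A)
  rwa [← Measure.prod_restrict, Measure.restrict_univ] at this

theorem setIntegral_timeIntegral {h : ℝ × Ω → ℝ} (hT : 0 ≤ T) (hh : Integrable h (timeProd P T))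
    (A : Set Ω) : ∫ ω in A, timeIntegral h (T, ω) ∂P = ∫ p, h p ∂(timeProd (P.restrict A) T) := by
  rw [integral_prod_symm _ (integrable_timeProd_restrict hh A)]
  simp only [timeIntegral, intervalIntegral_eq_setIntegral_Icc hT]

end TimeIntegral

/-! ### Occupation indicators and their compensators -/

section Compensator

variable {Ω : Type*} {J : ℕ}

/-- The indicator of `Z(t) = j`. -/
noncomputable def occ (Z : ℝ → Ω → State J) (j : State J) (p : ℝ × Ω) : ℝ :=
  if Z p.1 p.2 = j then 1 else 0

/-- The density of the compensator of `1_{Z(t) = j}`. -/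
noncomputable def compRate (μ : State J → State J → ℝ → ℝ) (Z : ℝ → Ω → State J) (j : State J)
    (p : ℝ × Ω) : ℝ :=
  rateMatrix μ p.1 (Z p.1 p.2) j

/-- The sum of the absolute values of all entries of the generator. -/
noncomputable def rateBound (μ : State J → State J → ℝ → ℝ) (t : ℝ) : ℝ :=
  ∑ i, ∑ j, |rateMatrix μ t i j|

/-- The martingale `1_{Z(t) = j} - ∫₀ᵗ λ_{Z(u) j}(u) du`, where `λ` is the generator. -/
noncomputable def compMartingale (μ : State J → State J → ℝ → ℝ) (Z : ℝ → Ω → State J)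
    (j : State J) (p : ℝ × Ω) : ℝ :=
  occ Z j p - timeIntegral (compRate μ Z j) p

variable {μ : State J → State J → ℝ → ℝ} {Z : ℝ → Ω → State J} {z₀ : State J}

/-- The generator applied to the indicator of j is its j-th column, which identifies the compensator
in the martingale problem. -/
theorem sum_rates_mul_eq_rateMatrix (μ : State J → State J → ℝ → ℝ) (t : ℝ) (i j : State J) :
    ∑ k ∈ Finset.univ.erase i, μ i k t * ((if k = j then (1 : ℝ) else 0) - if i = j then 1 else 0)
      = rateMatrix μ t i j := by
  by_cases h : i = j
  · subst h
    simp only [rateMatrix, exitRate, if_true, ← Finset.sum_neg_distrib]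
    refine Finset.sum_congr rfl fun k hk => ?_
    rw [if_neg (Finset.ne_of_mem_erase hk)]
    ring
  · simp only [rateMatrix, if_neg h, sub_zero, mul_ite, mul_one, mul_zero]
    rw [Finset.sum_ite_eq' (Finset.univ.erase i), if_pos
      (Finset.mem_erase.2 ⟨Ne.symm h, Finset.mem_univ j⟩)]

theorem compRate_eq_sum (μ : State J → State J → ℝ → ℝ) (Z : ℝ → Ω → State J) (j : State J)
    (p : ℝ × Ω) : compRate μ Z j p = ∑ k, occ Z k p * rateMatrix μ p.1 k j := by
  simp only [occ, ite_mul, one_mul, zero_mul, Finset.sum_ite_eq, Finset.mem_univ, if_true,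
    compRate]

theorem abs_rateMatrix_le_rateBound (μ : State J → State J → ℝ → ℝ) (t : ℝ) (i j : State J) :
    |rateMatrix μ t i j| ≤ rateBound μ t :=
  (Finset.single_le_sum (f := fun j => |rateMatrix μ t i j|) (fun _ _ => abs_nonneg _)
    (Finset.mem_univ j)).trans
    (Finset.single_le_sum (f := fun i => ∑ j, |rateMatrix μ t i j|)
      (fun _ _ => Finset.sum_nonneg fun _ _ => abs_nonneg _) (Finset.mem_univ i))

theorem occ_mem_Icc (Z : ℝ → Ω → State J) (j : State J) (p : ℝ × Ω) :
    occ Z j p ∈ Icc (0 : ℝ) 1 := by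
  simp only [occ]
  split_ifs <;> simp

theorem abs_occ_le (Z : ℝ → Ω → State J) (j : State J) (p : ℝ × Ω) : |occ Z j p| ≤ 1 := by
  rw [abs_of_nonneg (occ_mem_Icc Z j p).1]
  exact (occ_mem_Icc Z j p).2

theorem IsMarketRates.integrable_rateMatrix (hμ : IsMarketRates μ) {T : ℝ} (hT : 0 ≤ T)
    (i j : State J) :
    Integrable (fun t => rateMatrix μ t i j) (volume.restrict (Icc 0 T)) := by
  have h : ∀ i j, i ≠ j → Integrable (μ i j) (volume.restrict (Icc 0 T)) := fun i j hij =>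
    (intervalIntegrable_iff_integrable_Icc hT).1 (hμ.integrable i j hij T hT)
  simp only [rateMatrix, exitRate]
  split_ifs with hij
  · exact (integrable_finsetSum _ fun k hk => h i k (Finset.ne_of_mem_erase hk).symm).neg
  · exact h i j hij

theorem IsMarketRates.integrable_rateBound (hμ : IsMarketRates μ) {T : ℝ} (hT : 0 ≤ T) :
    Integrable (rateBound μ) (volume.restrict (Icc 0 T)) :=
  integrable_finsetSum _ fun i _ => integrable_finsetSum _ fun j _ =>
    (hμ.integrable_rateMatrix hT i j).abs

theorem measurable_hist_occ (Z : ℝ → Ω → State J) (j : State J) {s t : ℝ} (hs : 0 ≤ s)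
    (hst : s ≤ t) : Measurable[hist Z t] fun ω => occ Z j (s, ω) :=
  (measurable_of_finite fun i : State J => if i = j then (1 : ℝ) else 0).comp
    (measurable_hist hs hst)

variable {G : MeasurableSpace Ω} [m : MeasurableSpace Ω] {P : Measure Ω} {T : ℝ}

theorem IsJumpProcess.aestronglyMeasurable_occ (hZ : IsJumpProcess Z z₀) (j : State J) :
    AEStronglyMeasurable (occ Z j) (timeProd P T) := by
  refine ⟨{p | 0 ≤ p.1 ∧ Z p.1 p.2 = j}.indicator fun _ => 1,
    stronglyMeasurable_const.indicator (hZ.measurableSet_state j), ?_⟩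
  filter_upwards [ae_timeProd_mem] with p hp
  simp only [occ, indicator, mem_ofPred_eq, hp.1, true_and]

theorem IsJumpProcess.aestronglyMeasurable_compRate (hZ : IsJumpProcess Z z₀)
    (hμ : IsMarketRates μ) (hT : 0 ≤ T) (j : State J) :
    AEStronglyMeasurable (compRate μ Z j) (timeProd P T) := by
  simp only [funext (compRate_eq_sum μ Z j)]
  exact Finset.aestronglyMeasurable_fun_sum _ fun k _ =>
    (hZ.aestronglyMeasurable_occ k).mul (hμ.integrable_rateMatrix hT k j).1.comp_fst

theorem IsMarkovWithRates.condExp_compMartingale (hZμ : IsMarkovWithRates P Z μ) (j : State J)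
    {s t : ℝ} (hs : 0 ≤ s) (hst : s ≤ t) :
    P[fun ω => compMartingale μ Z j (t, ω) | hist Z s]
      =ᵐ[P] fun ω => compMartingale μ Z j (s, ω) := by
  have h := hZμ.martingale (fun k => if k = j then 1 else 0) s t hs hst
  simp only [sum_rates_mul_eq_rateMatrix] at h
  exact h

variable [IsProbabilityMeasure P]

theorem IsJumpProcess.integrable_occ_eval (hZ : IsJumpProcess Z z₀) (j : State J) {t : ℝ}
    (ht : 0 ≤ t) : Integrable (fun ω => occ Z j (t, ω)) P :=
  Integrable.of_bound ((measurable_hist_occ Z j ht le_rfl).mono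
    (hist_le hZ.measurable t) le_rfl).aestronglyMeasurable 1
    (Eventually.of_forall fun ω => abs_occ_le Z j (t, ω))

theorem IsJumpProcess.integrable_compRate (hZ : IsJumpProcess Z z₀) (hμ : IsMarketRates μ)
    (hT : 0 ≤ T) (j : State J) : Integrable (compRate μ Z j) (timeProd P T) :=
  ((hμ.integrable_rateBound hT).comp_fst P).mono' (hZ.aestronglyMeasurable_compRate hμ hT j)
    (Eventually.of_forall fun p => abs_rateMatrix_le_rateBound μ p.1 _ j)

theorem IsJumpProcess.integrable_compMartingale_eval (hZ : IsJumpProcess Z z₀)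
    (hμ : IsMarketRates μ) (j : State J) {t : ℝ} (ht : 0 ≤ t) :
    Integrable (fun ω => compMartingale μ Z j (t, ω)) P :=
  (hZ.integrable_occ_eval j ht).sub
    (integrable_timeIntegral_eval ht (hZ.integrable_compRate hμ ht j))

theorem IsJumpProcess.ae_integrable_compRate (hZ : IsJumpProcess Z z₀)
    (hμ : IsMarketRates μ) (hT : 0 ≤ T) (j : State J) :
    ∀ᵐ ω ∂P, Integrable (fun u => compRate μ Z j (u, ω)) (volume.restrict (Icc 0 T)) :=
  ae_integrable_section (hZ.integrable_compRate hμ hT j)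

theorem IsJumpProcess.ae_abs_compMartingale_le (hZ : IsJumpProcess Z z₀)
    (hμ : IsMarketRates μ) (hT : 0 ≤ T) (j : State J) :
    ∀ᵐ ω ∂P, ∀ t ∈ Icc 0 T, ‖compMartingale μ Z j (t, ω)‖ ≤ 1 + ∫ u in Icc 0 T, rateBound μ u := by
  filter_upwards [hZ.ae_integrable_compRate (P := P) hμ hT j] with ω hω t ht
  refine (abs_sub _ _).trans (add_le_add (abs_occ_le Z j _) ?_)
  refine (abs_timeIntegral_le ht hω).trans ?_
  exact integral_mono hω.abs (hμ.integrable_rateBound hT)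
    fun u => abs_rateMatrix_le_rateBound μ u _ j

/-- The compensated indicators remain martingales after an independent enlargement of the
filtration. -/
theorem condExp_sup_compMartingale (hZ : IsJumpProcess Z z₀)
    (hZμ : IsMarkovWithRates P Z μ) (hG : G ≤ m)
    (hind : ∀ t, 0 ≤ t → Indep (hist Z t) G P) (j : State J) {s t : ℝ} (hs : 0 ≤ s)
    (hst : s ≤ t) :
    P[fun ω => compMartingale μ Z j (t, ω) | G ⊔ hist Z s]
      =ᵐ[P] fun ω => compMartingale μ Z j (s, ω) := by
  have ht := hs.trans hst
  -- The martingale identity with both times equal to t shows that M_j(t) agrees almost surely with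
  -- a `hist Z t`-measurable variable, as the independent enlargement requires.
  have h1 := hZμ.condExp_compMartingale j ht le_rfl
  have h2 := condExp_sup_of_indep hG (hist_le hZ.measurable t) (hist_mono hst) (hind t ht)
    (X := P[fun ω => compMartingale μ Z j (t, ω) | hist Z t])
    stronglyMeasurable_condExp integrable_condExp
  exact (condExp_congr_ae h1.symm).trans
    (h2.trans ((condExp_congr_ae h1).trans (hZμ.condExp_compMartingale j hs hst)))

/-- Product rule for `∫ h du` and `1_{Z(t) = j}` after taking expectations on an event that is
independent of `Z`. -/
theorem setIntegral_timeIntegral_mul_occ (hZ : IsJumpProcess Z z₀) (hμ : IsMarketRates μ)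
    (hZμ : IsMarkovWithRates P Z μ) (hG : G ≤ m)
    (hind : ∀ t, 0 ≤ t → Indep (hist Z t) G P) (j : State J) {t : ℝ} (ht : 0 ≤ t)
    {h : ℝ × Ω → ℝ} (hh : Integrable h (timeProd P t))
    (hhG : ∀ᵐ u ∂(volume.restrict (Icc 0 t)),
      AEStronglyMeasurable[G ⊔ hist Z u] (fun ω => h (u, ω)) P)
    {A : Set Ω} (hA : MeasurableSet[G] A) :
    ∫ ω in A, timeIntegral h (t, ω) * occ Z j (t, ω) ∂P
      = ∫ p, h p * occ Z j p + timeIntegral h p * compRate μ Z j p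
          ∂(timeProd (P.restrict A) t) := by
  set C := 1 + ∫ u in Icc 0 t, rateBound μ u
  have hMb := hZ.ae_abs_compMartingale_le (P := P) hμ ht j
  have hMm : AEStronglyMeasurable (compMartingale μ Z j) (timeProd P t) :=
    (hZ.aestronglyMeasurable_occ j).sub
      (aestronglyMeasurable_timeIntegral (hZ.aestronglyMeasurable_compRate hμ ht j))
  have hMt := hZ.integrable_compMartingale_eval (P := P) hμ j ht
  have htt : t ∈ Icc 0 t := ⟨ht, le_rfl⟩
  have hhM : Integrable (fun p => h p * compMartingale μ Z j p) (timeProd P t) :=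
    hh.mul_bdd hMm (ae_timeProd_of_ae hMb)
  have hhMt : Integrable (fun p : ℝ × Ω => h p * compMartingale μ Z j (t, p.2)) (timeProd P t) :=
    hh.mul_bdd hMt.1.comp_snd (ae_timeProd_of_ae (hMb.mono fun ω hω _ _ => hω t htt))
  have hHA : Integrable (fun p => timeIntegral h p * compRate μ Z j p) (timeProd P t) :=
    integrable_timeIntegral_mul hh (hZ.aestronglyMeasurable_compRate hμ ht j)
      (hμ.integrable_rateBound ht)
      (Eventually.of_forall fun p => abs_rateMatrix_le_rateBound μ p.1 _ j)
  have hhocc : Integrable (fun p => h p * occ Z j p) (timeProd P t) :=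
    hh.mul_bdd (hZ.aestronglyMeasurable_occ j) (Eventually.of_forall fun p => abs_occ_le Z j p)
  -- The compensator is the indicator minus the bounded martingale, so its product with h inherits
  -- integrability from the two preceding products.
  have hhI : Integrable (fun p => h p * timeIntegral (compRate μ Z j) p) (timeProd P t) := by
    refine (hhocc.sub hhM).congr (Eventually.of_forall fun p => ?_)
    simp only [compMartingale, Pi.sub_apply]
    ring
  have hIA : Integrable (fun p => h p * timeIntegral (compRate μ Z j) p
      + timeIntegral h p * compRate μ Z j p) (timeProd P t) := hhI.add hHA
  have hbddt : ∀ᵐ ω ∂P, ‖compMartingale μ Z j (t, ω)‖ ≤ C := hMb.mono fun ω hω => hω t htt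
  have hHt := integrable_timeIntegral_eval ht hh
  have hHM : Integrable (fun ω => timeIntegral h (t, ω) * compMartingale μ Z j (t, ω)) P :=
    hHt.mul_bdd hMt.1 hbddt
  -- the martingale part
  have hmart : ∫ ω in A, timeIntegral h (t, ω) * compMartingale μ Z j (t, ω) ∂P
      = ∫ p, h p * compMartingale μ Z j p ∂(timeProd (P.restrict A) t) := by
    -- M_j(t) does not depend on the integration time u and can be moved inside ∫₀ᵗ h(u) du.
    have h1 : ∫ ω in A, timeIntegral h (t, ω) * compMartingale μ Z j (t, ω) ∂P
        = ∫ p, h p * compMartingale μ Z j (t, p.2) ∂(timeProd (P.restrict A) t) := by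
      rw [integral_prod_symm _ (integrable_timeProd_restrict hhMt A)]
      simp only [timeIntegral, intervalIntegral_eq_setIntegral_Icc ht, integral_mul_const]
    rw [h1, integral_prod _ (integrable_timeProd_restrict hhMt A),
      integral_prod _ (integrable_timeProd_restrict hhM A)]
    refine integral_congr_ae ?_
    filter_upwards [hhG, hhMt.prod_right_ae, hh.prod_right_ae,
      ae_restrict_mem measurableSet_Icc] with u hu hint hint' hmem
    -- For fixed u, h(u) factors out of the conditional expectation given G ⊔ hist Z u, which
    -- replaces M_j(t) by M_j(u).
    have hle : G ⊔ hist Z u ≤ m := sup_le hG (hist_le hZ.measurable u)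
    rw [← setIntegral_condExp hle hint (le_sup_left (a := G) _ hA)]
    refine integral_congr_ae (ae_restrict_of_ae ?_)
    filter_upwards [condExp_mul_of_aestronglyMeasurable_left (g := fun ω =>
        compMartingale μ Z j (t, ω)) hu hint hMt,
      condExp_sup_compMartingale hZ hZμ hG hind j hmem.1 hmem.2] with ω h2 h3
    exact h2.trans (congrArg (h (u, ω) * ·) h3)
  -- the compensator part
  have hcomp : ∫ ω in A, timeIntegral h (t, ω) * timeIntegral (compRate μ Z j) (t, ω) ∂P
      = ∫ p, h p * timeIntegral (compRate μ Z j) p + timeIntegral h p * compRate μ Z j p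
          ∂(timeProd (P.restrict A) t) := by
    rw [← setIntegral_timeIntegral ht hIA]
    refine integral_congr_ae (ae_restrict_of_ae ?_)
    filter_upwards [hZ.ae_integrable_compRate (P := P) hμ ht j, ae_integrable_section hh]
      with ω h1 h2
    exact intervalIntegral_mul_intervalIntegral
      ((intervalIntegrable_iff_integrable_Icc ht).2 h2)
      ((intervalIntegrable_iff_integrable_Icc ht).2 h1)
  have hHI : Integrable
      (fun ω => timeIntegral h (t, ω) * timeIntegral (compRate μ Z j) (t, ω)) P := by
    refine ((hHt.mul_bdd (hZ.integrable_occ_eval j ht).1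
      (Eventually.of_forall fun ω => abs_occ_le Z j (t, ω))).sub hHM).congr
      (Eventually.of_forall fun ω => ?_)
    simp only [compMartingale, Pi.sub_apply]
    ring
  have hsplit : ∀ ω, timeIntegral h (t, ω) * occ Z j (t, ω)
      = timeIntegral h (t, ω) * compMartingale μ Z j (t, ω)
        + timeIntegral h (t, ω) * timeIntegral (compRate μ Z j) (t, ω) := fun ω => by
    simp only [compMartingale]
    ring
  simp only [hsplit]
  rw [integral_add hHM.integrableOn hHI.integrableOn, hmart, hcomp,
    ← integral_add (integrable_timeProd_restrict hhM A)
      (integrable_timeProd_restrict hIA A)]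
  refine integral_congr_ae (Eventually.of_forall fun p => ?_)
  simp only [compMartingale]
  ring

end Compensator

/-! ### Continuity of the modified transition probabilities -/

section Continuity

theorem eventually_nhds_of_left_right {q : ℝ → Prop} {t : ℝ} (hl : ∀ᶠ u in 𝓝[<] t, q u) (ht : q t)
    (hr : ∀ᶠ u in 𝓝[>] t, q u) : ∀ᶠ u in 𝓝 t, q u := by
  rw [← nhdsLT_sup_nhdsGE, ← Ioi_insert, nhdsWithin_insert, eventually_sup, eventually_sup]
  exact ⟨hl, ht, hr⟩

theorem eventually_nhdsGE_of_right {q : ℝ → Prop} {t : ℝ} (ht : q t)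
    (hr : ∀ᶠ u in 𝓝[>] t, q u) : ∀ᶠ u in 𝓝[≥] t, q u := by
  rw [← Ioi_insert, nhdsWithin_insert, eventually_sup]
  exact ⟨ht, hr⟩

variable {Ω : Type*} {J : ℕ} {μ : State J → State J → ℝ → ℝ} {Z : ℝ → Ω → State J} {z₀ : State J}
  {ρ : ℝ → ℝ}

theorem abs_occ_mul_conversionFactor_le (hρ : ∀ t, ρ t ∈ Icc (0 : ℝ) 1) (j : State J)
    (p : ℝ × Ω) : ‖occ Z j p * conversionFactor ρ Z p.1 p.2‖ ≤ 1 := by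
  have h := conversionFactor_mem_Icc (Z := Z) hρ p.1 p.2
  rw [norm_mul, Real.norm_eq_abs, Real.norm_eq_abs, abs_of_nonneg h.1]
  exact mul_le_one₀ (abs_occ_le Z j p) h.1 h.2

variable {G : MeasurableSpace Ω} [m : MeasurableSpace Ω] {P : Measure Ω} {T : ℝ}

theorem aestronglyMeasurable_comp_fst (f : ℝ → ℝ)
    (hf : AEStronglyMeasurable f (volume.restrict (Icc 0 T))) :
    AEStronglyMeasurable[MeasurableSpace.prod inferInstance G] (fun p : ℝ × Ω => f p.1)
      (timeProd P T) := by
  obtain ⟨g, hg, hfg⟩ := hf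
  exact ⟨fun p => g p.1, hg.comp_measurable (@measurable_fst ℝ Ω _ G),
    Measure.quasiMeasurePreserving_fst.ae hfg⟩

variable [IsProbabilityMeasure P]

/-- On {Z(s) = i} the indicator of j starts from 0, so by the martingale property its mean at time t
is the mean growth of the compensator over [s, t]. -/
theorem measureReal_state_inter_le (hZ : IsJumpProcess Z z₀) (hμ : IsMarketRates μ)
    (hZμ : IsMarkovWithRates P Z μ) {i j : State J} (hij : i ≠ j) {s t : ℝ} (hs : 0 ≤ s)
    (hst : s ≤ t) :
    P.real {ω | Z s ω = i ∧ Z t ω = j} ≤ ∫ u in s..t, rateBound μ u := by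
  have ht := hs.trans hst
  have hB : MeasurableSet[hist Z s] {ω | Z s ω = i} :=
    measurable_hist hs le_rfl (measurableSet_singleton i)
  have hle := hist_le hZ.measurable s
  have hbI : IntervalIntegrable (rateBound μ) volume s t :=
    (((intervalIntegrable_iff_integrable_Icc hs).2 (hμ.integrable_rateBound hs)).symm).trans
      ((intervalIntegrable_iff_integrable_Icc ht).2 (hμ.integrable_rateBound ht))
  have hb0 : 0 ≤ ∫ u in s..t, rateBound μ u := intervalIntegral.integral_nonneg hst fun u _ =>
    Finset.sum_nonneg fun _ _ => Finset.sum_nonneg fun _ _ => abs_nonneg _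
  have h1 : ∫ ω in {ω | Z s ω = i}, compMartingale μ Z j (t, ω) ∂P
      = ∫ ω in {ω | Z s ω = i}, compMartingale μ Z j (s, ω) ∂P := by
    rw [← setIntegral_condExp hle (hZ.integrable_compMartingale_eval hμ j ht) hB]
    exact integral_congr_ae (ae_restrict_of_ae (hZμ.condExp_compMartingale j hs hst))
  have h2 : ∫ ω in {ω | Z s ω = i}, occ Z j (t, ω) ∂P = P.real {ω | Z s ω = i ∧ Z t ω = j} := by
    have hC : MeasurableSet {ω | Z s ω = i ∧ Z t ω = j} :=
      (hle _ hB).inter (hZ.measurable t ht (measurableSet_singleton j))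
    rw [← integral_indicator_one hC, ← integral_indicator (hle _ hB)]
    refine integral_congr_ae (Eventually.of_forall fun ω => ?_)
    by_cases hi : Z s ω = i <;> by_cases hj : Z t ω = j <;> simp [indicator, occ, hi, hj]
  have hI : ∀ r, 0 ≤ r → Integrable (fun ω => timeIntegral (compRate μ Z j) (r, ω)) P :=
    fun r hr => integrable_timeIntegral_eval hr (hZ.integrable_compRate hμ hr j)
  have h3 : ∫ ω in {ω | Z s ω = i}, occ Z j (t, ω) ∂P
      = ∫ ω in {ω | Z s ω = i}, (timeIntegral (compRate μ Z j) (t, ω)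
        - timeIntegral (compRate μ Z j) (s, ω)) ∂P := by
    have h4 : ∫ ω in {ω | Z s ω = i}, occ Z j (s, ω) ∂P = 0 := by
      refine setIntegral_eq_zero_of_forall_eq_zero fun ω hω => ?_
      simp only [mem_ofPred_eq] at hω
      simp [occ, hω, hij]
    simp only [compMartingale] at h1
    rw [integral_sub (hZ.integrable_occ_eval j ht).integrableOn (hI t ht).integrableOn,
      integral_sub (hZ.integrable_occ_eval j hs).integrableOn (hI s hs).integrableOn, h4] at h1
    rw [integral_sub (hI t ht).integrableOn (hI s hs).integrableOn]
    linarith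
  rw [← h2, h3]
  calc ∫ ω in {ω | Z s ω = i}, (timeIntegral (compRate μ Z j) (t, ω)
        - timeIntegral (compRate μ Z j) (s, ω)) ∂P
      ≤ ∫ ω in {ω | Z s ω = i}, (∫ u in s..t, rateBound μ u) ∂P := by
        refine integral_mono_ae ((hI t ht).sub (hI s hs)).integrableOn
          (integrable_const _) (ae_restrict_of_ae ?_)
        filter_upwards [hZ.ae_integrable_compRate (P := P) hμ ht j] with ω hω
        have hωt := (intervalIntegrable_iff_integrable_Icc ht).2 hω
        have hωs : IntervalIntegrable (fun u => compRate μ Z j (u, ω)) volume 0 s :=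
          hωt.mono_set (by rw [uIcc_of_le hs, uIcc_of_le ht]; exact Icc_subset_Icc_right hst)
        simp only [timeIntegral]
        rw [intervalIntegral.integral_interval_sub_left hωt hωs]
        exact intervalIntegral.integral_mono_on hst (hωs.symm.trans hωt) hbI
          fun u _ => (le_abs_self _).trans (abs_rateMatrix_le_rateBound μ u _ j)
    _ = P.real {ω | Z s ω = i} * ∫ u in s..t, rateBound μ u := by
        rw [setIntegral_const, smul_eq_mul]
    _ ≤ ∫ u in s..t, rateBound μ u := mul_le_of_le_one_left hb0 measureReal_le_one

/-- The state process has no fixed jump times. -/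
theorem ae_eventually_nhdsLT_eq (hZ : IsJumpProcess Z z₀) (hμ : IsMarketRates μ)
    (hZμ : IsMarkovWithRates P Z μ) {t : ℝ} (ht : 0 < t) :
    ∀ᵐ ω ∂P, ∀ᶠ u in 𝓝[<] t, Z u ω = Z t ω := by
  -- A sequence in [0, t) increasing to t. If the left limit at t is i and Z(t) = j, then Z(s n) = i
  -- for all large n, an event whose probability is at most the vanishing rate integral over [s n,
  -- t].
  set s : ℕ → ℝ := fun n => t - t / (n + 1)
  have hdiv : ∀ n : ℕ, 0 < t / (n + 1) := fun n => by positivity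
  have hs0 : ∀ n, 0 ≤ s n := fun n => sub_nonneg.2 (div_le_self ht.le (by simp))
  have hslt : ∀ n, s n < t := fun n => sub_lt_self _ (hdiv n)
  have hslim : Tendsto s atTop (𝓝 t) := by
    have := tendsto_const_div_atTop_nhds_zero_nat t
    have h := (tendsto_add_atTop_iff_nat (f := fun n : ℕ => t / n) 1).2 this
    simpa [s] using h.const_sub t
  have hsw : Tendsto s atTop (𝓝[<] t) :=
    tendsto_nhdsWithin_iff.2 ⟨hslim, Eventually.of_forall hslt⟩
  have hbt := (intervalIntegrable_iff_integrable_Icc ht.le).2 (hμ.integrable_rateBound ht.le)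
  have hlim : Tendsto (fun n => ∫ u in (s n)..t, rateBound μ u) atTop (𝓝 0) := by
    have hc : ContinuousOn (fun x => ∫ u in t..x, rateBound μ u) (uIcc 0 t) :=
      intervalIntegral.continuousOn_primitive_interval' hbt right_mem_uIcc
    have h := (hc t right_mem_uIcc).tendsto.comp (tendsto_nhdsWithin_iff.2 ⟨hslim,
      Eventually.of_forall fun n => by
        rw [uIcc_of_le ht.le]
        exact ⟨hs0 n, (hslt n).le⟩⟩)
    rw [intervalIntegral.integral_same] at h
    simpa [intervalIntegral.integral_symm t] using h.neg
  have hnull : ∀ i j : State J, i ≠ j →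
      ∀ᵐ ω ∂P, ¬ ((∀ᶠ u in 𝓝[<] t, Z u ω = i) ∧ Z t ω = j) := by
    intro i j hij
    rw [ae_iff]
    refine measure_mono_null (t := ⋃ N : ℕ, ⋂ n ≥ N, {ω | Z (s n) ω = i ∧ Z t ω = j}) ?_ ?_
    · intro ω hω
      simp only [not_not, mem_ofPred_eq] at hω
      obtain ⟨N, hN⟩ := eventually_atTop.1 (hsw.eventually hω.1)
      exact mem_iUnion.2 ⟨N, mem_iInter₂.2 fun n hn => ⟨hN n hn, hω.2⟩⟩
    · refine measure_iUnion_null fun N => le_antisymm ?_ zero_le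
      refine ge_of_tendsto (f := fun n => ENNReal.ofReal (∫ u in (s n)..t, rateBound μ u))
        (by simpa using ENNReal.tendsto_ofReal hlim) ?_
      filter_upwards [eventually_ge_atTop N] with n hn
      refine (measure_mono (biInter_subset_of_mem hn)).trans ?_
      rw [← ofReal_measureReal]
      exact ENNReal.ofReal_le_ofReal
        (measureReal_state_inter_le hZ hμ hZμ hij (hs0 n) (hslt n).le)
  have hall : ∀ᵐ ω ∂P, ∀ i j : State J, i ≠ j →
      ¬ ((∀ᶠ u in 𝓝[<] t, Z u ω = i) ∧ Z t ω = j) := by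
    refine ae_all_iff.2 fun i => ae_all_iff.2 fun j => ?_
    by_cases hij : i = j
    · exact Eventually.of_forall fun ω h => absurd hij h
    · exact (hnull i j hij).mono fun ω hω _ => hω
  filter_upwards [hall] with ω hω
  obtain ⟨i, hi⟩ := hZ.left_limits ω t ht
  by_cases hit : i = Z t ω
  · rwa [← hit]
  · exact absurd ⟨hi, rfl⟩ (hω i (Z t ω) hit)

/-- Treats p as the case ρ ≡ 1 of p^ρ, so that continuity and conditioning are proved only once. -/
theorem prob_eq_integral (hZ : IsJumpProcess Z z₀) (j : State J) {t : ℝ} (ht : 0 ≤ t) :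
    prob P Z z₀ j t = probRho P (fun _ => 1) Z z₀ j t := by
  have h : {ω | Z 0 ω = z₀} = univ := eq_univ_of_forall hZ.initial
  rw [prob, probRho, h, cond_univ, ← integral_indicator_one
    (s := {ω | Z t ω = j}) (hZ.measurable t ht (measurableSet_singleton j))]
  refine integral_congr_ae (Eventually.of_forall fun ω => ?_)
  simp only [indicator, conversionFactor_one, Pi.one_apply]

theorem probRho_eq_integral (hZ : IsJumpProcess Z z₀) (j : State J) (t : ℝ) :
    probRho P ρ Z z₀ j t = ∫ ω, occ Z j (t, ω) * conversionFactor ρ Z t ω ∂P := by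
  have h : {ω | Z 0 ω = z₀} = univ := eq_univ_of_forall hZ.initial
  rw [probRho, h, cond_univ]
  refine integral_congr_ae (Eventually.of_forall fun ω => ?_)
  by_cases hj : Z t ω = j <;> simp [indicator, occ, hj]

theorem measurable_hist_occ_mul_conversionFactor (hZ : IsJumpProcess Z z₀) (hρm : Measurable ρ)
    (j : State J) {t : ℝ} (ht : 0 ≤ t) :
    Measurable[hist Z t] fun ω => occ Z j (t, ω) * conversionFactor ρ Z t ω :=
  (measurable_hist_occ Z j ht le_rfl).mul (hZ.measurable_hist_conversionFactor hρm ht)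

/-- Dominated convergence: the integrand is bounded by 1 and, for almost every ω, constant near t.
To the right this is right-continuity of Z, to the left the absence of fixed jump times. -/
theorem continuousWithinAt_probRho (hZ : IsJumpProcess Z z₀) (hμ : IsMarketRates μ)
    (hZμ : IsMarkovWithRates P Z μ) (hρm : Measurable ρ) (hρ : ∀ t, ρ t ∈ Icc (0 : ℝ) 1)
    (j : State J) {t : ℝ} (ht : 0 ≤ t) :
    ContinuousWithinAt (probRho P ρ Z z₀ j) (Ici 0) t := by
  simp only [ContinuousWithinAt, funext (probRho_eq_integral (P := P) (ρ := ρ) hZ j)]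
  refine tendsto_integral_filter_of_dominated_convergence (fun _ => 1) ?_ ?_
    (integrable_const _) ?_
  · filter_upwards [self_mem_nhdsWithin] with u hu
    exact ((measurable_hist_occ_mul_conversionFactor hZ hρm j hu).mono
      (hist_le hZ.measurable u) le_rfl).aestronglyMeasurable
  · exact Eventually.of_forall fun u => Eventually.of_forall fun ω =>
      abs_occ_mul_conversionFactor_le hρ j (u, ω)
  · have hr : ∀ ω, ∀ᶠ u in 𝓝[>] t, occ Z j (u, ω) * conversionFactor ρ Z u ω
        = occ Z j (t, ω) * conversionFactor ρ Z t ω := fun ω => by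
      filter_upwards [hZ.right_continuous ω t ht, conversionFactor_eventuallyEq_nhdsGT (Z := Z) ρ ω t]
        with u h1 h2
      simp only [occ, h1, h2]
    rcases ht.eq_or_lt with rfl | ht0
    · refine Eventually.of_forall fun ω => tendsto_const_nhds.congr' ?_
      filter_upwards [eventually_nhdsGE_of_right
        (q := fun u => occ Z j (u, ω) * conversionFactor ρ Z u ω
          = occ Z j (0, ω) * conversionFactor ρ Z 0 ω) rfl (hr ω)] with u hu
      exact hu.symm
    · filter_upwards [ae_eventually_nhdsLT_eq hZ hμ hZμ ht0] with ω hω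
      refine tendsto_const_nhds.congr' (mem_nhdsWithin_of_mem_nhds ?_)
      refine eventually_nhds_of_left_right ?_ rfl ((hr ω).mono fun u hu => hu.symm)
      filter_upwards [hω, hZ.conversionFactor_eventuallyEq_nhdsLT ρ ht0 hω] with u h1 h2
      simp only [occ, h1, h2]

theorem IsJumpProcess.integrable_occ_mul_conversionFactor (hZ : IsJumpProcess Z z₀)
    (hρm : Measurable ρ) (hρ : ∀ t, ρ t ∈ Icc (0 : ℝ) 1) (j : State J) :
    Integrable (fun p => occ Z j p * conversionFactor ρ Z p.1 p.2) (timeProd P T) :=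
  Integrable.of_bound ((hZ.aestronglyMeasurable_occ j).mul
    (hZ.measurable_conversionFactor hρm).aestronglyMeasurable) 1
    (Eventually.of_forall fun p => abs_occ_mul_conversionFactor_le hρ j p)

/-- Conditionally on information that is independent of `Z`, the process
`1_{Z(t) = j} ρ(τ)^{1_{τ ≤ t}}` has mean `p^ρ_{z₀ j}(0, t)`. -/
theorem condExp_timeProd_occ_mul_conversionFactor (hZ : IsJumpProcess Z z₀)
    (hμ : IsMarketRates μ) (hZμ : IsMarkovWithRates P Z μ) (hG : G ≤ m)
    (hind : ∀ t, 0 ≤ t → Indep (hist Z t) G P)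
    (hρm : Measurable ρ) (hρ : ∀ t, ρ t ∈ Icc (0 : ℝ) 1) (j : State J) :
    (timeProd P T)[fun p => occ Z j p * conversionFactor ρ Z p.1 p.2
        | MeasurableSpace.prod inferInstance G]
      =ᵐ[timeProd P T] fun p => probRho P ρ Z z₀ j p.1 := by
  have hcont : ContinuousOn (probRho P ρ Z z₀ j) (Icc 0 T) := fun t ht =>
    (continuousWithinAt_probRho hZ hμ hZμ hρm hρ j ht.1).mono fun u hu => hu.1
  have hint := hZ.integrable_occ_mul_conversionFactor (P := P) (T := T) hρm hρ j
  have hint' : Integrable (fun p : ℝ × Ω => probRho P ρ Z z₀ j p.1) (timeProd P T) :=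
    (hcont.integrableOn_Icc (μ := volume)).comp_fst P
  refine (ae_eq_condExp_prod_of_rectangles hG hint hint'
    (aestronglyMeasurable_comp_fst _ (hcont.aestronglyMeasurable measurableSet_Icc)) ?_).symm
  intro B A hB hA
  -- For each fixed time the factor is determined by Z and A by G, so the expectation over A splits
  -- into P(A) times the mean.
  rw [setIntegral_prod _ hint.integrableOn, setIntegral_prod _ hint'.integrableOn]
  refine integral_congr_ae (ae_restrict_of_ae ?_)
  filter_upwards [ae_restrict_mem measurableSet_Icc] with u hu
  rw [setIntegral_const, smul_eq_mul, probRho_eq_integral hZ]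
  have hm := measurable_hist_occ_mul_conversionFactor hZ hρm j hu.1
  exact setIntegral_eq_of_indep hG (hist_le hZ.measurable u) (hind u hu.1) hm.stronglyMeasurable
    (Integrable.of_bound (hm.mono (hist_le hZ.measurable u) le_rfl).aestronglyMeasurable 1
      (Eventually.of_forall fun ω => abs_occ_mul_conversionFactor_le hρ j (u, ω))) hA

end Continuity

/-! ### The differential equations in integrated form -/

section Primitive

variable {F d : ℝ → ℝ}

theorem ae_hasDerivAt_of_eq_integral (hd : ∀ t, 0 ≤ t → IntervalIntegrable d volume 0 t)
    (hF : ∀ t, 0 ≤ t → F t = ∫ u in (0 : ℝ)..t, d u) :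
    ∀ᵐ t ∂(volume.restrict (Ioi (0 : ℝ))), HasDerivAt F (d t) t := by
  rw [ae_restrict_iff' measurableSet_Ioi]
  have h : ∀ᵐ t, ∀ n : ℕ, t ∈ uIcc (0 : ℝ) n → ∀ c ∈ uIcc (0 : ℝ) n,
      HasDerivAt (fun x => ∫ u in c..x, d u) (d t) t :=
    ae_all_iff.2 fun n => (hd n n.cast_nonneg).ae_hasDerivAt_integral
  filter_upwards [h] with t ht ht0
  obtain ⟨n, hn⟩ := exists_nat_ge t
  refine (ht n ?_ 0 left_mem_uIcc).congr_of_eventuallyEq ?_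
  · rw [uIcc_of_le n.cast_nonneg]
    exact ⟨(mem_Ioi.1 ht0).le, hn⟩
  · filter_upwards [Ioi_mem_nhds ht0] with s hs using hF s (mem_Ioi.1 hs).le

theorem continuousWithinAt_of_eq_integral (hd : ∀ t, 0 ≤ t → IntervalIntegrable d volume 0 t)
    (hF : ∀ t, 0 ≤ t → F t = ∫ u in (0 : ℝ)..t, d u) {t : ℝ} (ht : 0 ≤ t) :
    ContinuousWithinAt F (Ici 0) t := by
  have h : ContinuousOn F (Icc 0 (t + 1)) := by
    have h1 := intervalIntegral.continuousOn_primitive_interval'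
      (hd (t + 1) (by linarith)) left_mem_uIcc
    rw [uIcc_of_le (by linarith)] at h1
    exact h1.congr fun s hs => hF s hs.1
  refine (h t ⟨ht, by linarith⟩).mono_of_mem_nhdsWithin ?_
  exact mem_nhdsWithin.2 ⟨Iio (t + 1), isOpen_Iio, by simp, fun s hs => ⟨hs.2, hs.1.le⟩⟩

theorem hasDerivWithinAt_of_eq_integral (hd : ∀ t, 0 ≤ t → IntervalIntegrable d volume 0 t)
    (hF : ∀ t, 0 ≤ t → F t = ∫ u in (0 : ℝ)..t, d u) {t : ℝ} (ht : 0 ≤ t)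
    (hc : ContinuousWithinAt d (Ici 0) t) : HasDerivWithinAt F (d t) (Ici 0) t := by
  have hm : AEStronglyMeasurable d (volume.restrict (Ioc 0 (t + 1))) :=
    (hd (t + 1) (by linarith)).1.aestronglyMeasurable
  have h : HasDerivWithinAt (fun x => ∫ u in (0 : ℝ)..x, d u) (d t) (Ici 0) t := by
    -- At 0 only the one-sided fundamental theorem of calculus is available; at interior points the
    -- two-sided one applies.
    rcases ht.eq_or_lt with rfl | ht0
    · exact intervalIntegral.integral_hasDerivWithinAt_right (hd 0 le_rfl) (t := Ioi 0)
        ⟨_, Ioc_mem_nhdsGT (by norm_num), hm⟩ (hc.mono Ioi_subset_Ici_self)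
    · exact (intervalIntegral.integral_hasDerivAt_right (hd t ht)
        ⟨_, Ioc_mem_nhds ht0 (by linarith), hm⟩
        (hc.continuousAt (Ici_mem_nhds ht0))).hasDerivWithinAt
  exact h.congr (fun s hs => hF s hs) (hF t ht)

end Primitive

theorem continuousWithinAt_qDrift {J : ℕ} {μ : State J → State J → ℝ → ℝ}
    {V p pρ d₀ d₁ d₂ q : State J → ℝ → ℝ} {j : State J} {s : Set ℝ} {t : ℝ}
    (hμ : ∀ k, k ≠ j → ContinuousWithinAt (μ j k) s t ∧ ContinuousWithinAt (μ k j) s t)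
    (hp : ContinuousWithinAt (p j) s t) (hpρ : ContinuousWithinAt (pρ j) s t)
    (hq : ∀ k, ContinuousWithinAt (q k) s t)
    (h₀ : ContinuousWithinAt (fun u => d₀ j u / V j u) s t)
    (h₁ : ContinuousWithinAt (fun u => d₁ j u / V j u) s t)
    (h₂ : ContinuousWithinAt (fun u => d₂ j u / V j u) s t) :
    ContinuousWithinAt (qDrift μ V p pρ d₀ d₁ d₂ q j) s t := by
  have h : qDrift μ V p pρ d₀ d₁ d₂ q j = fun u =>
      p j u * (d₀ j u / V j u) + pρ j u * (d₁ j u / V j u) + q j u * (d₂ j u / V j u)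
        - q j u * exitRate μ j u + ∑ k ∈ Finset.univ.erase j, q k u * μ k j u := by
    funext u
    simp only [qDrift, add_div, mul_div_assoc]
  rw [h]
  have hexit : ContinuousWithinAt (exitRate μ j) s t :=
    tendsto_finsetSum _ fun k hk => (hμ k (Finset.ne_of_mem_erase hk)).1
  have hin : ContinuousWithinAt (fun u => ∑ k ∈ Finset.univ.erase j, q k u * μ k j u) s t :=
    tendsto_finsetSum _ fun k hk => (hq k).mul (hμ k (Finset.ne_of_mem_erase hk)).2
  exact (((((hp.mul h₀).add (hpρ.mul h₁)).add ((hq j).mul h₂))).sub ((hq j).mul hexit)).add hin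

theorem qDrift_eq_sum {J : ℕ} (μ : State J → State J → ℝ → ℝ)
    (V p pρ d₀ d₁ d₂ q : State J → ℝ → ℝ) (j : State J) (t : ℝ) :
    qDrift μ V p pρ d₀ d₁ d₂ q j t = d₀ j t / V j t * p j t + d₁ j t / V j t * pρ j t
      + d₂ j t / V j t * q j t + ∑ k, rateMatrix μ t k j * q k t := by
  rw [← Finset.add_sum_erase Finset.univ _ (Finset.mem_univ j)]
  have h : ∑ k ∈ Finset.univ.erase j, rateMatrix μ t k j * q k t
      = ∑ k ∈ Finset.univ.erase j, q k t * μ k j t := Finset.sum_congr rfl fun k hk => by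
    rw [rateMatrix, if_neg (Finset.ne_of_mem_erase hk), mul_comm]
  rw [h, qDrift, rateMatrix, if_pos rfl, add_div, add_div]
  ring

theorem aestronglyMeasurable_sum_of_le {Ω ι : Type*} [Fintype ι] {m G : MeasurableSpace Ω}
    {P : Measure[m] Ω} {f : ι → Ω → ℝ} (hf : ∀ i, AEStronglyMeasurable[G] (f i) P) :
    AEStronglyMeasurable[G] (fun ω => ∑ i, f i ω) P := by
  rw [← Finset.sum_fn]
  exact Finset.sum_induction f (fun g => AEStronglyMeasurable[G] g P) (fun _ _ => .add)
    aestronglyMeasurable_const fun i _ => hf i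

/-! ### The bonus rate: adaptedness and integrability -/

section Bonus

variable {Ω : Type*} {J : ℕ} {μ : State J → State J → ℝ → ℝ} {Z : ℝ → Ω → State J} {z₀ : State J}
  {S : ℝ → Ω → ℝ × ℝ} {ρ : ℝ → ℝ} {V : State J → ℝ → ℝ} {δ δ₀ δ₁ δ₂ : State J → ℝ → Ω → ℝ}
  {Q : ℝ → Ω → ℝ}

/-- The rate `δ(t) / V_{Z(t)}(t)` at which additional benefits are bought. -/
noncomputable def bonusRate (ρ : ℝ → ℝ) (Z : ℝ → Ω → State J) (V : State J → ℝ → ℝ)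
    (δ₀ δ₁ δ₂ : State J → ℝ → Ω → ℝ) (Q : ℝ → Ω → ℝ) (p : ℝ × Ω) : ℝ :=
  dividendYield ρ Z δ₀ δ₁ δ₂ Q p.1 p.2 / V (Z p.1 p.2) p.1

/-- The drift of `Q(t) 1_{Z(t) = j}`, where `h` is the drift of `Q`. -/
noncomputable def occDrift (μ : State J → State J → ℝ → ℝ) (Z : ℝ → Ω → State J)
    (h : ℝ × Ω → ℝ) (j : State J) (p : ℝ × Ω) : ℝ :=
  h p * occ Z j p + timeIntegral h p * compRate μ Z j p

theorem hist_le_iSup (t : ℝ) : hist S t ≤ ⨆ t, hist S t := le_iSup (hist S) t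

variable [m : MeasurableSpace Ω] {P : Measure Ω}

theorem iSup_hist_le (hS : ∀ t, 0 ≤ t → Measurable (S t)) : ⨆ t, hist S t ≤ m :=
  iSup_le fun t => hist_le hS t

theorem indep_hist_iSup [IsProbabilityMeasure P] (hZ : IsJumpProcess Z z₀)
    (hS : ∀ t, 0 ≤ t → Measurable (S t)) (hZS : ∀ t, 0 ≤ t → Indep (hist Z t) (hist S t) P)
    {t : ℝ} (ht : 0 ≤ t) : Indep (hist Z t) (⨆ t, hist S t) P := by
  refine (indep_iSup_of_monotone (fun s => ?_) (fun s => hist_le hS s)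
    (hist_le hZ.measurable t) hist_mono).symm
  -- The hypothesis compares both histories at one common time; passing to max(s, t) and shrinking
  -- both histories covers all pairs s, t.
  exact indep_of_indep_of_le_left (indep_of_indep_of_le_right
    (hZS (max s t) (ht.trans (le_max_right _ _))).symm (hist_mono (le_max_right _ _)))
    (hist_mono (le_max_left _ _))

variable {T : ℝ}

theorem IsBonusProcess.integrable_bonusRate (hQ : IsBonusProcess P V ρ S Z δ₀ δ₁ δ₂ Q)
    (hT : 0 ≤ T) : Integrable (bonusRate ρ Z V δ₀ δ₁ δ₂ Q) (timeProd P T) := by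
  refine (((hQ.integrable₀ T hT).add (hQ.integrable₁ T hT)).add (hQ.integrable₂ T hT)).congr
    (Eventually.of_forall fun p => ?_)
  simp only [bonusRate, dividendYield, add_div, Pi.add_apply]

theorem IsBonusProcess.ae_eq_timeIntegral (hQ : IsBonusProcess P V ρ S Z δ₀ δ₁ δ₂ Q) :
    ∀ᵐ ω ∂P, ∀ t, 0 ≤ t → Q t ω = timeIntegral (bonusRate ρ Z V δ₀ δ₁ δ₂ Q) (t, ω) :=
  hQ.integral_eq

theorem IsBonusProcess.aestronglyMeasurable_bonusRate (hZ : IsJumpProcess Z z₀)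
    (hρm : Measurable ρ)
    (hδ₀ : IsDividendCoefficient P S δ₀) (hδ₁ : IsDividendCoefficient P S δ₁)
    (hδ₂ : IsDividendCoefficient P S δ₂) (hQ : IsBonusProcess P V ρ S Z δ₀ δ₁ δ₂ Q)
    {u : ℝ} (hu : 0 ≤ u) :
    AEStronglyMeasurable[(⨆ t, hist S t) ⊔ hist Z u]
      (fun ω => bonusRate ρ Z V δ₀ δ₁ δ₂ Q (u, ω)) P := by
  have hSle : hist S u ≤ (⨆ t, hist S t) ⊔ hist Z u := (hist_le_iSup u).trans le_sup_left
  have hδ : ∀ {δ : State J → ℝ → Ω → ℝ}, IsDividendCoefficient P S δ → ∀ j,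
      AEStronglyMeasurable[(⨆ t, hist S t) ⊔ hist Z u] (δ j u) P := fun h j =>
    (h.adapted j u hu).mono hSle
  have hQu : AEStronglyMeasurable[(⨆ t, hist S t) ⊔ hist Z u] (Q u) P :=
    (hQ.adapted u hu).mono (sup_le_sup_right (hist_le_iSup u) _)
  have hc : AEStronglyMeasurable[(⨆ t, hist S t) ⊔ hist Z u] (conversionFactor ρ Z u) P :=
    ((hZ.measurable_hist_conversionFactor hρm hu).mono (le_sup_right (a := ⨆ t, hist S t))
      le_rfl).stronglyMeasurable.aestronglyMeasurable
  have hocc : ∀ j, AEStronglyMeasurable[(⨆ t, hist S t) ⊔ hist Z u]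
      (fun ω => occ Z j (u, ω)) P := fun j =>
    ((measurable_hist_occ Z j hu le_rfl).mono (le_sup_right (a := ⨆ t, hist S t))
      le_rfl).stronglyMeasurable.aestronglyMeasurable
  -- Splitting over the finitely many values of Z(u) removes the random index from δ_i and V.
  have h : (fun ω => bonusRate ρ Z V δ₀ δ₁ δ₂ Q (u, ω)) = fun ω => ∑ j, occ Z j (u, ω)
      * ((δ₀ j u ω + δ₁ j u ω * conversionFactor ρ Z u ω + δ₂ j u ω * Q u ω) * (V j u)⁻¹) := by
    funext ω
    simp only [occ, ite_mul, one_mul, zero_mul, Finset.sum_ite_eq, Finset.mem_univ, if_true,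
      bonusRate, dividendYield, div_eq_mul_inv]
  rw [h]
  exact aestronglyMeasurable_sum_of_le fun j => (hocc j).mul
    ((((hδ hδ₀ j).add ((hδ hδ₁ j).mul hc)).add ((hδ hδ₂ j).mul hQu)).mul
      aestronglyMeasurable_const)

theorem IsDividendCoefficient.aestronglyMeasurable_div [IsProbabilityMeasure P]
    (hδ : IsDividendCoefficient P S δ) (hS : ∀ t, 0 ≤ t → Measurable (S t)) {j : State J}
    (hV : ∃ g : ℝ → ℝ, Measurable g ∧ ∀ t, 0 ≤ t → V j t = g t) :
    AEStronglyMeasurable[MeasurableSpace.prod inferInstance (⨆ t, hist S t)]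
      (fun p : ℝ × Ω => δ j p.1 p.2 / V j p.1) (timeProd P T) := by
  obtain ⟨g, hg, hVg⟩ := hV
  have h : AEStronglyMeasurable[MeasurableSpace.prod inferInstance (⨆ t, hist S t)]
      (fun p : ℝ × Ω => δ j p.1 p.2 / g p.1) (timeProd P T) := by
    refine aestronglyMeasurable_prod_of_sections (iSup_hist_le hS)
      ((hδ.measurable j).div (hg.comp measurable_fst)) ?_
    filter_upwards [ae_restrict_mem measurableSet_Icc] with u hu
    simp only [div_eq_mul_inv]
    exact ((hδ.adapted j u hu.1).mono (hist_le_iSup u)).mul aestronglyMeasurable_const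
  refine h.congr ?_
  filter_upwards [ae_timeProd_mem] with p hp
  rw [hVg p.1 hp.1]

theorem integrable_mul_occ (hZ : IsJumpProcess Z z₀) {h : ℝ × Ω → ℝ}
    (hh : Integrable h (timeProd P T)) (j : State J) :
    Integrable (fun p => h p * occ Z j p) (timeProd P T) :=
  hh.mul_bdd (hZ.aestronglyMeasurable_occ j) (Eventually.of_forall fun p => abs_occ_le Z j p)

variable [IsProbabilityMeasure P]

theorem integrable_timeIntegral_mul_occ (hZ : IsJumpProcess Z z₀) {h : ℝ × Ω → ℝ}
    (hh : Integrable h (timeProd P T)) (j : State J) :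
    Integrable (fun p => timeIntegral h p * occ Z j p) (timeProd P T) :=
  integrable_timeIntegral_mul (b := fun _ => 1) hh (hZ.aestronglyMeasurable_occ j)
    (integrable_const _) (Eventually.of_forall fun p => abs_occ_le Z j p)

theorem integrable_timeIntegral_mul_compRate (hZ : IsJumpProcess Z z₀) (hμ : IsMarketRates μ)
    {h : ℝ × Ω → ℝ} (hT : 0 ≤ T) (hh : Integrable h (timeProd P T)) (j : State J) :
    Integrable (fun p => timeIntegral h p * compRate μ Z j p) (timeProd P T) :=
  integrable_timeIntegral_mul hh (hZ.aestronglyMeasurable_compRate hμ hT j)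
    (hμ.integrable_rateBound hT)
    (Eventually.of_forall fun p => abs_rateMatrix_le_rateBound μ p.1 _ j)

theorem integrable_occDrift (hZ : IsJumpProcess Z z₀) (hμ : IsMarketRates μ)
    {h : ℝ × Ω → ℝ} (hT : 0 ≤ T) (hh : Integrable h (timeProd P T)) (j : State J) :
    Integrable (occDrift μ Z h j) (timeProd P T) :=
  (integrable_mul_occ hZ hh j).add (integrable_timeIntegral_mul_compRate hZ hμ hT hh j)

end Bonus

/-- `ψ j` is, on every `[0, T] × Ω`, a version of the conditional expectation of the drift of
`1_{Z(t) = j} ∫₀ᵗ h du` given the product of the time axis with `G`. -/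
def IsDriftVersion {Ω : Type*} {J : ℕ} (G : MeasurableSpace Ω) [MeasurableSpace Ω]
    (P : Measure Ω) (μ : State J → State J → ℝ → ℝ)
    (Z : ℝ → Ω → State J) (h : ℝ × Ω → ℝ) (ψ : State J → ℝ × Ω → ℝ) : Prop :=
  ∀ j, StronglyMeasurable[MeasurableSpace.prod inferInstance G] (ψ j) ∧
    ∀ T, 0 ≤ T → ψ j =ᵐ[timeProd P T]
      (timeProd P T)[occDrift μ Z h j | MeasurableSpace.prod inferInstance G]

/-! ### Integrating the conditional drift -/

section Version

variable {Ω : Type*} {J : ℕ} {μ : State J → State J → ℝ → ℝ} {Z : ℝ → Ω → State J} {z₀ : State J}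
  {G : MeasurableSpace Ω} [m : MeasurableSpace Ω] {P : Measure Ω}
  {h : ℝ × Ω → ℝ} {ψ : State J → ℝ × Ω → ℝ} {T : ℝ}

theorem setIntegral_univ_prod [SFinite P] (f : ℝ × Ω → ℝ) (A : Set Ω) :
    ∫ p in univ ×ˢ A, f p ∂(timeProd P T) = ∫ p, f p ∂(timeProd (P.restrict A) T) := by
  rw [← Measure.prod_restrict, Measure.restrict_univ]

theorem IsDriftVersion.integrable (hψ : IsDriftVersion G P μ Z h ψ) (hT : 0 ≤ T) (j : State J) :
    Integrable (ψ j) (timeProd P T) :=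
  integrable_condExp.congr ((hψ j).2 T hT).symm

variable [IsProbabilityMeasure P] (hZ : IsJumpProcess Z z₀) (hμ : IsMarketRates μ) (hZμ : IsMarkovWithRates P Z μ)
  (hG : G ≤ m) (hind : ∀ t, 0 ≤ t → Indep (hist Z t) G P)
  (hh : ∀ T, 0 ≤ T → Integrable h (timeProd P T))
  (hhG : ∀ u, 0 ≤ u → AEStronglyMeasurable[G ⊔ hist Z u] (fun ω => h (u, ω)) P)
include hZ hμ hZμ hG hind hh hhG

theorem IsDriftVersion.setIntegral_eq (hψ : IsDriftVersion G P μ Z h ψ) (j : State J) {t : ℝ}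
    (ht : 0 ≤ t) {A : Set Ω} (hA : MeasurableSet[G] A) :
    ∫ ω in A, timeIntegral (ψ j) (t, ω) ∂P
      = ∫ ω in A, timeIntegral h (t, ω) * occ Z j (t, ω) ∂P := by
  have hmem : ∀ᵐ u ∂(volume.restrict (Icc 0 t)),
      AEStronglyMeasurable[G ⊔ hist Z u] (fun ω => h (u, ω)) P := by
    filter_upwards [ae_restrict_mem measurableSet_Icc] with u hu using hhG u hu.1
  rw [setIntegral_timeIntegral_mul_occ hZ hμ hZμ hG hind j ht (hh t ht) hmem hA,
    setIntegral_timeIntegral ht (hψ.integrable ht j), ← setIntegral_univ_prod,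
    ← setIntegral_univ_prod, integral_congr_ae (ae_restrict_of_ae ((hψ j).2 t ht))]
  exact setIntegral_condExp (prod_le_prod hG) (integrable_occDrift hZ hμ ht (hh t ht) j)
    (@MeasurableSet.prod ℝ Ω _ G _ _ MeasurableSet.univ hA)

theorem IsDriftVersion.ae_eq_condExp (hψ : IsDriftVersion G P μ Z h ψ) (j : State J) {t : ℝ}
    (ht : 0 ≤ t) :
    (fun ω => timeIntegral (ψ j) (t, ω))
      =ᵐ[P] P[fun ω => timeIntegral h (t, ω) * occ Z j (t, ω) | G] := by
  refine ae_eq_condExp_of_forall_setIntegral_eq hG ?_ (fun _ _ _ => ?_)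
    (fun A hA _ => hψ.setIntegral_eq hZ hμ hZμ hG hind hh hhG j ht hA) ?_
  · exact (integrable_timeIntegral_eval ht (hh t ht)).mul_bdd (hZ.integrable_occ_eval j ht).1
      (Eventually.of_forall fun ω => abs_occ_le Z j (t, ω))
  · exact (integrable_timeIntegral_eval ht (hψ.integrable ht j)).integrableOn
  · exact ((stronglyMeasurable_timeIntegral (m := G) (hψ j).1).comp_measurable
      (@measurable_prodMk_left ℝ Ω _ G t)).aestronglyMeasurable

/-- The counterpart on [0,T] × Ω of the fixed-time identity. It allows ∫ψ_k to be substituted for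
the conditional mean of Q 1_{Z=k} inside the drift, which closes the system. -/
theorem IsDriftVersion.timeIntegral_ae_eq_condExp (hψ : IsDriftVersion G P μ Z h ψ) (hT : 0 ≤ T)
    (j : State J) :
    timeIntegral (ψ j) =ᵐ[timeProd P T]
      (timeProd P T)[fun p => timeIntegral h p * occ Z j p
        | MeasurableSpace.prod inferInstance G] := by
  have hint := integrable_timeIntegral_mul_occ hZ (hh T hT) j
  have hint' := integrable_timeIntegral (hψ.integrable hT j)
  refine ae_eq_condExp_prod_of_rectangles hG hint hint'
    (stronglyMeasurable_timeIntegral (m := G) (hψ j).1).aestronglyMeasurable fun B A hB hA => ?_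
  rw [setIntegral_prod _ hint.integrableOn, setIntegral_prod _ hint'.integrableOn]
  refine integral_congr_ae (ae_restrict_of_ae ?_)
  filter_upwards [ae_restrict_mem measurableSet_Icc] with u hu
  exact (hψ.setIntegral_eq hZ hμ hZμ hG hind hh hhG j hu.1 hA).symm

omit hind hhG hZμ in
theorem exists_isDriftVersion : ∃ ψ, IsDriftVersion G P μ Z h ψ := by
  choose ψ hψ using fun j => exists_condExp_prod_version (P := P) hG
    (φ := occDrift μ Z h j) fun T hT => integrable_occDrift hZ hμ hT (hh T hT) j
  exact ⟨ψ, hψ⟩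

end Version

/-! ### Identification of the conditional drift -/

section Drift

variable {Ω : Type*} {J : ℕ} {μ : State J → State J → ℝ → ℝ} {Z : ℝ → Ω → State J} {z₀ : State J}
  {S : ℝ → Ω → ℝ × ℝ} {ρ : ℝ → ℝ} {V : State J → ℝ → ℝ} {δ₀ δ₁ δ₂ : State J → ℝ → Ω → ℝ}
  {Q : ℝ → Ω → ℝ} [m : MeasurableSpace Ω] {P : Measure Ω} [IsProbabilityMeasure P]
  {ψ : State J → ℝ × Ω → ℝ} {T : ℝ}

/-- The conditional drift is the right-hand side of the differential equations. -/
theorem IsDriftVersion.ae_eq_qDrift (hZ : IsJumpProcess Z z₀) (hμ : IsMarketRates μ)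
    (hZμ : IsMarkovWithRates P Z μ) (hS : ∀ t, 0 ≤ t → Measurable (S t))
    (hZS : ∀ t, 0 ≤ t → Indep (hist Z t) (hist S t) P)
    (hρm : Measurable ρ) (hρ : ∀ t, ρ t ∈ Icc (0 : ℝ) 1)
    (hV : ∀ j, ∃ g : ℝ → ℝ, Measurable g ∧ ∀ t, 0 ≤ t → V j t = g t)
    (hδ₀ : IsDividendCoefficient P S δ₀) (hδ₁ : IsDividendCoefficient P S δ₁)
    (hδ₂ : IsDividendCoefficient P S δ₂) (hQ : IsBonusProcess P V ρ S Z δ₀ δ₁ δ₂ Q)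
    (hψ : IsDriftVersion (⨆ t, hist S t) P μ Z (bonusRate ρ Z V δ₀ δ₁ δ₂ Q) ψ)
    (hT : 0 ≤ T) (j : State J) :
    ψ j =ᵐ[timeProd P T] fun p => qDrift μ V (prob P Z z₀) (probRho P ρ Z z₀)
      (fun k t => δ₀ k t p.2) (fun k t => δ₁ k t p.2) (fun k t => δ₂ k t p.2)
      (fun k t => timeIntegral (ψ k) (t, p.2)) j p.1 := by
  set h := bonusRate ρ Z V δ₀ δ₁ δ₂ Q with hhdef
  have hG : ⨆ t, hist S t ≤ m := iSup_hist_le hS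
  have hind : ∀ t, 0 ≤ t → Indep (hist Z t) (⨆ t, hist S t) P := fun t ht => indep_hist_iSup hZ hS hZS ht
  have hh : ∀ T, 0 ≤ T → Integrable h (timeProd P T) := fun T hT => hQ.integrable_bonusRate hT
  have hhG : ∀ u, 0 ≤ u → AEStronglyMeasurable[(⨆ t, hist S t) ⊔ hist Z u] (fun ω => h (u, ω)) P :=
    fun u hu => hQ.aestronglyMeasurable_bonusRate hZ hρm hδ₀ hδ₁ hδ₂ hu
  have hQae : ∀ᵐ p ∂(timeProd P T), Q p.1 p.2 = timeIntegral h p :=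
    ae_timeProd_of_ae (hQ.ae_eq_timeIntegral.mono fun ω hω t ht => hω t ht.1)
  set D₀ : ℝ × Ω → ℝ := fun p => δ₀ j p.1 p.2 / V j p.1 with hD₀
  set D₁ : ℝ × Ω → ℝ := fun p => δ₁ j p.1 p.2 / V j p.1 with hD₁
  set D₂ : ℝ × Ω → ℝ := fun p => δ₂ j p.1 p.2 / V j p.1 with hD₂
  set c : ℝ × Ω → ℝ := fun p => occ Z j p * conversionFactor (fun _ => 1) Z p.1 p.2 with hc
  set cρ : ℝ × Ω → ℝ := fun p => occ Z j p * conversionFactor ρ Z p.1 p.2 with hcρ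
  set X : State J → ℝ × Ω → ℝ := fun k p => timeIntegral h p * occ Z k p with hX
  set R : State J → ℝ × Ω → ℝ := fun k p => rateMatrix μ p.1 k j with hR
  have hone : ∀ _ : ℝ, (1 : ℝ) ∈ Icc (0 : ℝ) 1 := fun _ => ⟨zero_le_one, le_rfl⟩
  have hcint : Integrable c (timeProd P T) :=
    hZ.integrable_occ_mul_conversionFactor measurable_const hone j
  have hcρint : Integrable cρ (timeProd P T) :=
    hZ.integrable_occ_mul_conversionFactor hρm hρ j
  have hXint : ∀ k, Integrable (X k) (timeProd P T) := fun k =>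
    integrable_timeIntegral_mul_occ hZ (hh T hT) k
  -- The coefficient δ_i(·,j)/V_j need not be integrable on its own. Its product with the indicator
  -- of {Z = j} is, by the assumption on the terms of δ/V, and pulling it out requires no more.
  have h₀ : Integrable (D₀ * c) (timeProd P T) := by
    refine (integrable_mul_occ hZ (hQ.integrable₀ T hT) j).congr (Eventually.of_forall fun p => ?_)
    by_cases hj : Z p.1 p.2 = j <;> simp [hD₀, hc, occ, hj, conversionFactor_one]
  have h₁ : Integrable (D₁ * cρ) (timeProd P T) := by
    refine (integrable_mul_occ hZ (hQ.integrable₁ T hT) j).congr (Eventually.of_forall fun p => ?_)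
    by_cases hj : Z p.1 p.2 = j <;> simp [hD₁, hcρ, occ, hj]
    ring
  have h₂ : Integrable (D₂ * X j) (timeProd P T) := by
    refine (integrable_mul_occ hZ (hQ.integrable₂ T hT) j).congr ?_
    filter_upwards [hQae] with p hp
    by_cases hj : Z p.1 p.2 = j <;> simp [hD₂, hX, occ, hj, hp]
    ring
  have h₃ : ∀ k, Integrable (R k * X k) (timeProd P T) := fun k => by
    refine (integrable_timeIntegral_mul (hh T hT) (g := fun p => occ Z k p * R k p)
      ((hZ.aestronglyMeasurable_occ k).mul (hμ.integrable_rateMatrix hT k j).1.comp_fst)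
      (hμ.integrable_rateBound hT) (Eventually.of_forall fun p => ?_)).congr
      (Eventually.of_forall fun p => ?_)
    · rw [abs_mul]
      exact (mul_le_of_le_one_left (abs_nonneg _) (abs_occ_le Z k p)).trans
        (abs_rateMatrix_le_rateBound μ p.1 k j)
    · simp only [hX, Pi.mul_apply]
      ring
  have hsum : Integrable (∑ k, R k * X k) (timeProd P T) :=
    integrable_finsetSum' _ fun k _ => h₃ k
  -- The drift as a sum of products: the first factor depends only on time and prices, the second
  -- carries the dependence on Z.
  have hφ : occDrift μ Z h j =ᵐ[timeProd P T] D₀ * c + D₁ * cρ + D₂ * X j + ∑ k, R k * X k := by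
    filter_upwards [hQae] with p hp
    have h4 : h p * occ Z j p = D₀ p * c p + D₁ p * cρ p + D₂ p * X j p := by
      by_cases hj : Z p.1 p.2 = j
      · have h6 : h p = dividendYield ρ Z δ₀ δ₁ δ₂ Q p.1 p.2 / V (Z p.1 p.2) p.1 := rfl
        simp only [h6, dividendYield, hD₀, hD₁, hD₂, hc, hcρ, hX, occ, hj, if_true,
          conversionFactor_one, ← hp]
        ring
      · simp [hc, hcρ, hX, occ, hj]
    have h5 : timeIntegral h p * compRate μ Z j p = ∑ k, R k p * X k p := by
      rw [compRate_eq_sum, Finset.mul_sum]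
      refine Finset.sum_congr rfl fun k _ => ?_
      simp only [hR, hX]
      ring
    simp only [occDrift, Pi.add_apply, Pi.mul_apply, Finset.sum_apply, h4, h5]
  have hDm : ∀ {δ : State J → ℝ → Ω → ℝ}, IsDividendCoefficient P S δ →
      AEStronglyMeasurable[MeasurableSpace.prod inferInstance (⨆ t, hist S t)]
        (fun p : ℝ × Ω => δ j p.1 p.2 / V j p.1) (timeProd P T) :=
    fun hδ => hδ.aestronglyMeasurable_div hS (hV j)
  have e₀ : (timeProd P T)[D₀ * c | MeasurableSpace.prod inferInstance (⨆ t, hist S t)]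
      =ᵐ[timeProd P T] D₀ * (timeProd P T)[c | MeasurableSpace.prod inferInstance (⨆ t, hist S t)] :=
    condExp_mul_of_aestronglyMeasurable_left (hDm hδ₀) h₀ hcint
  have e₁ : (timeProd P T)[D₁ * cρ | MeasurableSpace.prod inferInstance (⨆ t, hist S t)]
      =ᵐ[timeProd P T] D₁ * (timeProd P T)[cρ | MeasurableSpace.prod inferInstance (⨆ t, hist S t)] :=
    condExp_mul_of_aestronglyMeasurable_left (hDm hδ₁) h₁ hcρint
  have e₂ : (timeProd P T)[D₂ * X j | MeasurableSpace.prod inferInstance (⨆ t, hist S t)]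
      =ᵐ[timeProd P T] D₂ * (timeProd P T)[X j | MeasurableSpace.prod inferInstance (⨆ t, hist S t)] :=
    condExp_mul_of_aestronglyMeasurable_left (hDm hδ₂) h₂ (hXint j)
  have e₃ : ∀ᵐ p ∂(timeProd P T), ∀ k,
      (timeProd P T)[R k * X k | MeasurableSpace.prod inferInstance (⨆ t, hist S t)] p
        = R k p * timeIntegral (ψ k) p := by
    refine ae_all_iff.2 fun k => ?_
    -- The market rates are deterministic, hence measurable for the time axis alone up to null sets.
    filter_upwards [condExp_mul_of_aestronglyMeasurable_left
        (aestronglyMeasurable_comp_fst _ (hμ.integrable_rateMatrix hT k j).1) (h₃ k) (hXint k),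
      hψ.timeIntegral_ae_eq_condExp hZ hμ hZμ hG hind hh hhG hT k] with p hp hp'
    rw [hp, Pi.mul_apply, hp']
  have hadd : (timeProd P T)[D₀ * c + D₁ * cρ + D₂ * X j + ∑ k, R k * X k
        | MeasurableSpace.prod inferInstance (⨆ t, hist S t)]
      =ᵐ[timeProd P T] (timeProd P T)[D₀ * c | MeasurableSpace.prod inferInstance (⨆ t, hist S t)]
        + (timeProd P T)[D₁ * cρ | MeasurableSpace.prod inferInstance (⨆ t, hist S t)]
        + (timeProd P T)[D₂ * X j | MeasurableSpace.prod inferInstance (⨆ t, hist S t)]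
        + ∑ k, (timeProd P T)[R k * X k | MeasurableSpace.prod inferInstance (⨆ t, hist S t)] :=
    (condExp_add ((h₀.add h₁).add h₂) hsum _).trans
      (((condExp_add (h₀.add h₁) h₂ _).trans
        ((condExp_add h₀ h₁ _).add (EventuallyEq.refl _ _))).add
        (condExp_finsetSum (fun k _ => h₃ k) _))
  filter_upwards [(hψ j).2 T hT, condExp_congr_ae (m := MeasurableSpace.prod inferInstance (⨆ t, hist S t)) hφ,
    hadd, e₀, e₁, e₂, e₃, hψ.timeIntegral_ae_eq_condExp hZ hμ hZμ hG hind hh hhG hT j,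
    condExp_timeProd_occ_mul_conversionFactor hZ hμ hZμ hG hind measurable_const hone j,
    condExp_timeProd_occ_mul_conversionFactor hZ hμ hZμ hG hind hρm hρ j, ae_timeProd_mem]
    with p p1 p2 p3 p4 p5 p6 p7 p8 p9 p10 p11
  have q4 := p4.trans (congrArg (D₀ p * ·) p9)
  have q5 := p5.trans (congrArg (D₁ p * ·) p10)
  have q6 := p6.trans (congrArg (D₂ p * ·) p8.symm)
  rw [p1, p2, p3]
  simp only [Pi.add_apply, Finset.sum_apply, q4, q5, q6, p7]
  rw [qDrift_eq_sum, prob_eq_integral hZ j p11.1]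

end Drift

end LifeBonus

/-! ### The differential equations for the `Q`-modified transition probabilities -/

theorem mainTheorem1
    {Ω : Type*} [MeasurableSpace Ω] (P : Measure Ω) [IsProbabilityMeasure P]
    {J : ℕ} (hJ : 0 < J)
    -- technical basis, predetermined payments, unit bonus payments
    (T : TechnicalBasis J) (B Bd : Payments J) (hB : B.Regular T) (hBd : Bd.Regular T)
    (hBd_rate : ∀ j t, 0 ≤ Bd.rate j t) (hBd_lump : ∀ j k t, 0 ≤ Bd.lump j k t)
    (hρ : ∀ t, freePolicyFactor hJ T B t ∈ Icc (0 : ℝ) 1)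
    -- state of the insured and financial market on the market basis
    (μ : State J → State J → ℝ → ℝ) (hμ : IsMarketRates μ)
    (z₀ : State J) (Z : ℝ → Ω → State J) (hZ : IsJumpProcess Z z₀)
    (hZμ : IsMarkovWithRates P Z μ)
    (S : ℝ → Ω → ℝ × ℝ) (hS : ∀ t, 0 ≤ t → Measurable (S t))
    (hZS : ∀ t, 0 ≤ t → Indep (hist Z t) (hist S t) P)
    -- dividends and number of additional benefits
    (δ₀ δ₁ δ₂ : State J → ℝ → Ω → ℝ)
    (hδ₀ : IsDividendCoefficient P S δ₀) (hδ₁ : IsDividendCoefficient P S δ₁)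
    (hδ₂ : IsDividendCoefficient P S δ₂)
    (Q : ℝ → Ω → ℝ)
    (hQ : IsBonusProcess P (unitReserve T Bd) (freePolicyFactor hJ T B) S Z δ₀ δ₁ δ₂ Q) :
    (∀ t, 0 ≤ t → Integrable (Q t) P) ∧
    ∃ pQ : State J → ℝ → Ω → ℝ,
      (∀ j t, 0 ≤ t → pQ j t =ᵐ[P] probQ P S Z Q j t) ∧
      ∀ᵐ ω ∂P, ∀ j : State J,
        let V := unitReserve T Bd
        let drift : ℝ → ℝ := qDrift μ V (prob P Z z₀) (probRho P (freePolicyFactor hJ T B) Z z₀)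
          (fun k t => δ₀ k t ω) (fun k t => δ₁ k t ω) (fun k t => δ₂ k t ω)
          (fun k t => pQ k t ω) j
        pQ j 0 ω = 0 ∧
        (∀ t, 0 ≤ t → IntervalIntegrable drift volume 0 t ∧
          pQ j t ω = ∫ u in (0 : ℝ)..t, drift u) ∧
        (∀ᵐ t ∂(volume.restrict (Ioi (0 : ℝ))),
          HasDerivAt (fun s => pQ j s ω) (drift t) t) ∧
        (∀ t, 0 ≤ t →
          (∀ k, k ≠ j → ContinuousWithinAt (μ j k) (Ici 0) t ∧
            ContinuousWithinAt (μ k j) (Ici 0) t) →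
          ContinuousWithinAt (fun s => δ₀ j s ω / V j s) (Ici 0) t →
          ContinuousWithinAt (fun s => δ₁ j s ω / V j s) (Ici 0) t →
          ContinuousWithinAt (fun s => δ₂ j s ω / V j s) (Ici 0) t →
          HasDerivWithinAt (fun s => pQ j s ω) (drift t) (Ici 0) t) := by
  have hρm := measurable_freePolicyFactor hJ T hB
  have hV := exists_measurable_unitReserve T hBd
  have hG := iSup_hist_le hS
  have hind : ∀ t, 0 ≤ t → Indep (hist Z t) (⨆ t, hist S t) P :=
    fun t ht => indep_hist_iSup hZ hS hZS ht
  set h := bonusRate (freePolicyFactor hJ T B) Z (unitReserve T Bd) δ₀ δ₁ δ₂ Q with hhdef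
  have hh : ∀ t, 0 ≤ t → Integrable h (timeProd P t) := fun t ht => hQ.integrable_bonusRate ht
  have hhG : ∀ u, 0 ≤ u →
      AEStronglyMeasurable[(⨆ t, hist S t) ⊔ hist Z u] (fun ω => h (u, ω)) P :=
    fun u hu => hQ.aestronglyMeasurable_bonusRate hZ hρm hδ₀ hδ₁ hδ₂ hu
  have hQint : ∀ t, 0 ≤ t → Integrable (Q t) P := fun t ht =>
    (integrable_timeIntegral_eval ht (hh t ht)).congr
      (hQ.ae_eq_timeIntegral.mono fun ω hω => (hω t ht).symm)
  obtain ⟨ψ, hψ⟩ := exists_isDriftVersion (P := P) hZ hμ hG hh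
  refine ⟨hQint, fun j t ω => timeIntegral (ψ j) (t, ω), fun j t ht => ?_, ?_⟩
  · have hjt : MeasurableSet[hist Z t] {ω | Z t ω = j} :=
      measurable_hist ht le_rfl (measurableSet_singleton j)
    have h1 : (fun ω => timeIntegral h (t, ω) * occ Z j (t, ω))
        =ᵐ[P] {ω | Z t ω = j}.indicator (Q t) := by
      filter_upwards [hQ.ae_eq_timeIntegral] with ω hω
      by_cases hj : Z t ω = j <;> simp [indicator, occ, hj, hω t ht, hhdef]
    refine (hψ.ae_eq_condExp hZ hμ hZμ hG hind hh hhG j ht).trans ((condExp_congr_ae h1).trans ?_)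
    -- Adaptedness of Q is what permits conditioning on `hist S t` in place of the whole price
    -- information.
    obtain ⟨g, hg, hQg⟩ := hQ.adapted t ht
    exact condExp_eq_of_indep hG (hist_le hZ.measurable t) (hist_le_iSup t) (hind t ht).symm
      ⟨_, hg.indicator (le_sup_right (a := hist S t) _ hjt), hQg.indicator⟩
      ((hQint t ht).indicator (hist_le hZ.measurable t _ hjt))
  -- Only finitely many states and integer horizons are involved, so one null set serves all times
  -- and all states.
  · have hae : ∀ᵐ ω ∂P, ∀ (j : State J) (n : ℕ),
        Integrable (fun u => ψ j (u, ω)) (volume.restrict (Icc 0 (n : ℝ))) ∧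
        ∀ᵐ u ∂(volume.restrict (Icc 0 (n : ℝ))), ψ j (u, ω)
          = qDrift μ (unitReserve T Bd) (prob P Z z₀) (probRho P (freePolicyFactor hJ T B) Z z₀)
            (fun k t => δ₀ k t ω) (fun k t => δ₁ k t ω) (fun k t => δ₂ k t ω)
            (fun k t => timeIntegral (ψ k) (t, ω)) j u := by
      refine ae_all_iff.2 fun j => ae_all_iff.2 fun n => ?_
      exact (ae_integrable_section (hψ.integrable n.cast_nonneg j)).and (ae_ae_of_ae_timeProd
        (hψ.ae_eq_qDrift hZ hμ hZμ hS hZS hρm hρ hV hδ₀ hδ₁ hδ₂ hQ n.cast_nonneg j))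
    filter_upwards [hae] with ω hω
    have hdrift : ∀ (j : State J) (t : ℝ), 0 ≤ t →
        IntervalIntegrable (qDrift μ (unitReserve T Bd) (prob P Z z₀)
          (probRho P (freePolicyFactor hJ T B) Z z₀) (fun k t => δ₀ k t ω) (fun k t => δ₁ k t ω)
          (fun k t => δ₂ k t ω) (fun k t => timeIntegral (ψ k) (t, ω)) j) volume 0 t ∧
        timeIntegral (ψ j) (t, ω) = ∫ u in (0 : ℝ)..t, qDrift μ (unitReserve T Bd) (prob P Z z₀)
          (probRho P (freePolicyFactor hJ T B) Z z₀) (fun k t => δ₀ k t ω) (fun k t => δ₁ k t ω)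
          (fun k t => δ₂ k t ω) (fun k t => timeIntegral (ψ k) (t, ω)) j u := by
      intro j t ht
      obtain ⟨n, hn⟩ := exists_nat_ge t
      have hle : volume.restrict (Icc 0 t) ≤ volume.restrict (Icc 0 (n : ℝ)) :=
        Measure.restrict_mono (Icc_subset_Icc_right hn) le_rfl
      have hae := ae_mono hle (hω j n).2
      rw [intervalIntegrable_iff_integrable_Icc ht, timeIntegral,
        intervalIntegral_eq_setIntegral_Icc ht, intervalIntegral_eq_setIntegral_Icc ht]
      exact ⟨((hω j n).1.mono_measure hle).congr hae, integral_congr_ae hae⟩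
    intro j V drift
    have hd : ∀ t, 0 ≤ t → IntervalIntegrable drift volume 0 t := fun t ht => (hdrift j t ht).1
    have hF : ∀ t, 0 ≤ t → timeIntegral (ψ j) (t, ω) = ∫ u in (0 : ℝ)..t, drift u :=
      fun t ht => (hdrift j t ht).2
    refine ⟨intervalIntegral.integral_same, hdrift j, ae_hasDerivAt_of_eq_integral hd hF,
      fun t ht hμc h₀ h₁ h₂ => hasDerivWithinAt_of_eq_integral hd hF ht ?_⟩
    have hp : ContinuousWithinAt (prob P Z z₀ j) (Ici 0) t :=
      (continuousWithinAt_probRho hZ hμ hZμ measurable_const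
        (fun _ => ⟨zero_le_one, le_rfl⟩) j ht).congr
        (fun s hs => prob_eq_integral hZ j hs) (prob_eq_integral hZ j ht)
    exact continuousWithinAt_qDrift hμc hp (continuousWithinAt_probRho hZ hμ hZμ hρm hρ j ht)
      (fun k => continuousWithinAt_of_eq_integral (fun s hs => (hdrift k s hs).1)
        (fun s hs => (hdrift k s hs).2) ht) h₀ h₁ h₂
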